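/- **Setting.** A PT-DFA is a tuple $(Q,\Sigma,\delta,\hat q,F)$ with finite sets $Q,\Sigma$, $\hat q\in Q$, $F\subseteq Q$, and a finite set $\delta\subseteq Q\times\Sigma\times Q$ of transitions such that $(q,a,q_1),(q,a,q_2)\in\delta$ implies $q_1=q_2$; write $\delta(q,a)=q_1$ if $(q,a,q_1)\in\delta$. A state is *relevant* if it is $\hat q$, or it is reachable from $\hat q$ and some state of $F$ is reachable from it. For $B\subseteq Q$, $a\in\Sigma$ let $\delta_{B,a}=\{(q,a,q')\in\delta : q'\in B\}$. **Abstract algorithm.** $\mathcal B:=\{F\}$ if $Q=F$, otherwise $\mathcal B:=\{F,Q\setminus F\}$. $\mathcal U:=\{(B,a): B\in\mathcal B,\ a\in\Sigma,\ \delta_{B,a}\ne\emptyset\}$. While $\mathcal U\neq\emptyset$: remove an arbitrary element $(B,a)$ from $\mathcal U$; then, in an arbitrary order, for each $C\in\mathcal B$ (as $\mathcal B$ is when this inner loop is entered) with $\delta(q,a)\in B$ for some $q\in C$: let $C_1:=\{q\in C:\delta(q,a)\in B\}$, $C_2:=C\setminus C_1$; if $C_2\neq\emptyset$, replace $C$ by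 $C_1,C_2$ in $\mathcal B$, let (small, big) be $(1,2)$ if $|C_1|\le|C_2|$ and $(2,1)$ otherwise, add to $\mathcal U$ all $(C_{\rm small},b)$ with $\delta_{C_{\rm small},b}\neq\emptyset$, then add all $(C_{\rm big},b)$ with $\delta_{C_{\rm big},b}\ne\emptyset$ and $(C,b)\in\mathcal U$, and then remove from $\mathcal U$ all pairs $(C,b)$. **Refinable partition.** A refinable partition of $\{1,\dots,max\}$ consists of a number $sets$ and arrays $elems,loc,sidx,first,end,mid$ with indices $1,\dots,max$. It is *consistent* if $elems$ and $loc$ are mutually inverse permutations of $\{1,\dots,max\}$, and the sets $s=1,\dots,sets$ occupy nonempty intervals of locations $first[s],\dots,end[s]-1$ with $first[s]\le mid[s]\le end[s]$, such that every element $e$ belongs to exactly the set $sidx[e]$, i.e. $first[s]\le loc[e]<end[s]$ if and only if $s=sidx[e]$. The set $s$ is $\{elems[i]:first[s]\le i<end[s]\}$, and its elements at locations before $mid[s]$ are marked. The structure *represents* a partition $P$ if it is consistent, no element is marked, and $P$ is the family of its sets. Operations: - $Size(s)=end[s]-first[s]$; $Set(e)=sidx[e]$; $First(s)=elems[first[s]]$;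 $Next(e)=0$ if $loc[e]+1\ge end[sidx[e]]$ and $elems[loc[e]+1]$ otherwise; $No\_marks(s)$ is true iff $mid[s]=first[s]$. - $Mark(e)$: $s:=sidx[e]$, $\ell:=loc[e]$, $m:=mid[s]$; if $\ell\ge m$ then $elems[\ell]:=elems[m]$, $loc[elems[\ell]]:=\ell$, $elems[m]:=e$, $loc[e]:=m$, $mid[s]:=m+1$. - $Split(s)$: if $mid[s]=end[s]$ then $mid[s]:=first[s]$; if $mid[s]=first[s]$ return $0$; otherwise $sets:=sets+1$, $first[sets]:=first[s]$, $mid[sets]:=first[s]$, $end[sets]:=mid[s]$, $first[s]:=mid[s]$, then $sidx[elems[\ell]]:=sets$ for $\ell=first[sets],\dots,end[sets]-1$, and return $sets$. A *simple set* of numbers in $1,\dots,c$ has room for $c$ numbers; $Add(i)$ inserts $i$ without checking whether it is already there, and $Remove$ removes and returns an arbitrary number in it. **Concrete algorithm.** The states and the transitions are numbered $1,\dots,|Q|$ and $1,\dots,|\delta|$ in an arbitrary way; $tail[t]$ is the number of the start state of transition $t$, and $In\_trs[q]$ is the set of the numbers of the transitions that end in state $q$. $BRP$ is a refinable partition of $\{1,\dots,|Q|\}$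 with initially one set ($sets=first[1]=mid[1]=1$, $end[1]=|Q|+1$, $elems[e]=loc[e]=e$, $sidx[e]=1$; all other entries arbitrary). $TRP$ is a refinable partition of $\{1,\dots,|\delta|\}$ with arbitrary contents. The simple sets $Unready\_Spls$, $Touched\_Spls$ (range $1,\dots,|\delta|$) and $Touched\_Blocks$ (range $1,\dots,|Q|$) are initially empty. $Split\_block(b)$: $b':=BRP.Split(b)$. If $b'\neq0$: if $BRP.Size(b)<BRP.Size(b')$ then $b':=b$; $q:=BRP.First(b')$; while $q\ne0$ do: for each $t\in In\_trs[q]$ in an arbitrary order: $p:=TRP.Set(t)$, if $TRP.No\_marks(p)$ then $Touched\_Spls.Add(p)$, and $TRP.Mark(t)$; then $q:=BRP.Next(q)$. After that, while $Touched\_Spls$ is nonempty: $p:=Touched\_Spls.Remove$, $p':=TRP.Split(p)$, if $p'\ne0$ then $Unready\_Spls.Add(p')$. $Main\_part$: make $TRP$ represent $\{\delta_{Q,a}: a\in\Sigma,\ \delta_{Q,a}\neq\emptyset\}$ (in an arbitrary one of the possible ways); $Unready\_Spls.Add(p)$ for $p=1,\dots,TRP.sets$; $BRP.Mark(q)$ for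 each $q\in F$ in an arbitrary order; $Split\_block(1)$. While $Unready\_Spls$ is nonempty: $p:=Unready\_Spls.Remove$; $t:=TRP.First(p)$; while $t\ne0$ do: $q:=tail[t]$, $b':=BRP.Set(q)$, if $BRP.No\_marks(b')$ then $Touched\_Blocks.Add(b')$, $BRP.Mark(q)$, $t:=TRP.Next(t)$; and after that, while $Touched\_Blocks$ is nonempty: $b:=Touched\_Blocks.Remove$, $Split\_block(b)$. **Theorem.** Let $(Q,\Sigma,\delta,\hat q,F)$ be a PT-DFA all whose states are relevant and that has at least one final state. Then the concrete algorithm computes the same $\mathcal B$ as the abstract algorithm. That is, there is a family $\mathcal B^*$ of subsets of $Q$ such that, whatever arbitrary choices are made, 1. executions of the abstract algorithm exist, all of them terminate, and all of them end with $\mathcal B=\mathcal B^*$; 2. for every numbering of the states and of the transitions and all initial contents as above, executions of the concrete algorithm ($Main\_part$) exist, all of them terminate without using an array index out of range, overfilling a simple set, adding to it a number outside its range, or removing from an empty one, and all of them end with $BRP$ representing $\mathcal B^*$ (each state being replaced by its number). -/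

import Mathlib

universe u v w

/-! ### Nondeterministic imperative computations -/

/-- A nondeterministic computation with state space `σ` that returns a value of type `α`.
`run s a s'`: some execution started in `s` ends in `s'` and returns `a`.
`ok s`: every execution started in `s` terminates, and none of them goes wrong
(array index out of range, removal from an empty set, choice from an empty set). -/
structure Comp (σ : Type u) (α : Type v) where
  run : σ → α → σ → Prop
  ok : σ → Prop

namespace Comp

variable {σ : Type u} {τ : Type w} {α β : Type v}

instance : Monad (Comp.{u, v} σ) where
  pure a :=
    { run := fun s b s' => b = a ∧ s' = s
      ok := fun _ => True }
  bind c f :=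
    { run := fun s b s'' => ∃ a s', c.run s a s' ∧ (f a).run s' b s''
      ok := fun s => c.ok s ∧ ∀ a s', c.run s a s' → (f a).ok s' }

/-- A value that depends on the current state. -/
def query (f : σ → α) : Comp σ α where
  run s a s' := a = f s ∧ s' = s
  ok _ := True

/-- A deterministic change of the state. -/
def update (f : σ → σ) : Comp σ PUnit.{v + 1} where
  run s _ s' := s' = f s
  ok _ := True

/-- Goes wrong unless `p` holds. -/
def check (p : Prop) : Comp σ PUnit.{v + 1} where
  run s _ s' := p ∧ s' = s
  ok _ := p

/-- Returns an arbitrary value `a` with `r s a s'`, changing the state to `s'`;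
goes wrong if there is none. -/
def choose (r : σ → α → σ → Prop) : Comp σ α where
  run := r
  ok s := ∃ a s', r s a s'

/-- A computation on a component of the state. -/
def zoom (proj : σ → τ) (put : τ → σ → σ) (c : Comp τ α) : Comp σ α where
  run s a s' := ∃ r, c.run (proj s) a r ∧ s' = put r s
  ok s := c.ok (proj s)

/-- The terminating executions of a **while** loop with a loop variable. -/
inductive LoopRun (cond : β → σ → Prop) (body : β → Comp σ β) : β → σ → β → σ → Prop
  | done {x : β} {s : σ} : ¬ cond x s → LoopRun cond body x s x s
  | step {x y z : β} {s s' s'' : σ} : cond x s → (body x).run s y s' →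
      LoopRun cond body y s' z s'' → LoopRun cond body x s z s''

/-- All executions of a **while** loop terminate without going wrong. -/
inductive LoopOk (cond : β → σ → Prop) (body : β → Comp σ β) : β → σ → Prop
  | done {x : β} {s : σ} : ¬ cond x s → LoopOk cond body x s
  | step {x : β} {s : σ} : cond x s → (body x).ok s →
      (∀ y s', (body x).run s y s' → LoopOk cond body y s') → LoopOk cond body x s

/-- `x := x₀; while cond x do x := body x`; returns the final `x`. -/
def loop (x₀ : β) (cond : β → σ → Prop) (body : β → Comp σ β) : Comp σ β where
  run s y s' := LoopRun cond body x₀ s y s'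
  ok s := LoopOk cond body x₀ s

/-- `while cond do body`. -/
def whileDo (cond : σ → Prop) (body : Comp σ PUnit.{v + 1}) : Comp σ PUnit.{v + 1} :=
  loop PUnit.unit (fun _ s => cond s) (fun _ => body)

/-- Executes `body x` for the members `x` of a list, in the order of the list. -/
def forList {ι : Type w} (body : ι → Comp σ PUnit.{v + 1}) : List ι → Comp σ PUnit.{v + 1}
  | [] => pure PUnit.unit
  | x :: l => do
    body x
    forList body l

/-- `for i := lo to hi do body i`, in increasing order. -/
def forTo (lo hi : ℕ) (body : ℕ → Comp σ PUnit.{v + 1}) : Comp σ PUnit.{v + 1} :=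
  forList body (List.range' lo (hi + 1 - lo))

/-- `for x ∈ S do body x`, where `S` is evaluated when the loop is entered: every
element of `S` exactly once, in an arbitrary order. -/
def forEach {ι : Type w} (S : σ → Finset ι) (body : ι → Comp σ PUnit.{v + 1}) :
    Comp σ PUnit.{v + 1} where
  run s a s' := ∃ l : List ι, l.Nodup ∧ (∀ x, x ∈ l ↔ x ∈ S s) ∧ (forList body l).run s a s'
  ok s := ∀ l : List ι, l.Nodup → (∀ x, x ∈ l ↔ x ∈ S s) → (forList body l).ok s

/-- Started in `s`, every execution terminates without going wrong, there is an execution,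
and every execution ends in a state that satisfies `post`. -/
def Guarantees (c : Comp σ PUnit.{v + 1}) (s : σ) (post : σ → Prop) : Prop :=
  c.ok s ∧ (∃ s', c.run s PUnit.unit s') ∧ ∀ s', c.run s PUnit.unit s' → post s'

end Comp

/-! ### Deterministic finite automata with a partial transition function -/

/-- A PT-DFA with set of states `Q` and alphabet `A`. -/
structure PTDFA (Q : Type u) (A : Type v) where
  δ : Finset (Q × A × Q)
  init : Q
  final : Finset Q
  det : ∀ q a q₁ q₂, (q, a, q₁) ∈ δ → (q, a, q₂) ∈ δ → q₁ = q₂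

namespace PTDFA

variable {Q : Type u} {A : Type v}

/-- `D.Path q w q'`: there is a path from `q` to `q'` labelled by the word `w`. -/
inductive Path (D : PTDFA Q A) : Q → List A → Q → Prop
  | nil (q : Q) : Path D q [] q
  | snoc {q q'' q' : Q} {w : List A} {a : A} :
      Path D q w q'' → (q'', a, q') ∈ D.δ → Path D q (w ++ [a]) q'

/-- A state is relevant if it is initial, or it is reachable from the initial state and
some final state is reachable from it. -/
def Relevant (D : PTDFA Q A) (q : Q) : Prop :=
  q = D.init ∨ ∃ q' ∈ D.final, ∃ x y : List A, D.Path D.init x q ∧ D.Path q y q'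

/-- `δ_{B,a}`: the transitions labelled `a` that end in `B`. -/
def into [DecidableEq Q] [DecidableEq A] (D : PTDFA Q A) (B : Finset Q) (a : A) :
    Finset (Q × A × Q) :=
  D.δ.filter fun t => t.2.2 ∈ B ∧ t.2.1 = a

/-- `δ(q,a) ∈ B`. -/
def Hits (D : PTDFA Q A) (B : Finset Q) (a : A) (q : Q) : Prop :=
  ∃ q' ∈ B, (q, a, q') ∈ D.δ

end PTDFA

/-! ### The abstract algorithm -/

/-- The variables of the abstract algorithm: the set `𝓑` of blocks and the set `𝓤` of
unprocessed splitters. -/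
structure AbsState (Q : Type u) (A : Type v) where
  blocks : Finset (Finset Q)
  unproc : Finset (Finset Q × A)

section Abstract

variable {Q : Type u} {A : Type v} [Fintype Q] [DecidableEq Q] [Fintype A] [DecidableEq A]

open Classical in
/-- The body of the **for** loop of the abstract algorithm for the block `C`
and the splitter `(B, a)`. -/
noncomputable def abstractSplit (D : PTDFA Q A) (B : Finset Q) (a : A) (C : Finset Q) :
    Comp (AbsState Q A) PUnit.{max u v + 1} := do
  let C₁ := C.filter fun q => D.Hits B a q
  let C₂ := C \ C₁
  if C₂ ≠ ∅ then
    Comp.update fun s => { s with blocks := s.blocks \ {C} }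
    Comp.update fun s => { s with blocks := s.blocks ∪ {C₁, C₂} }
    let small := if C₁.card ≤ C₂.card then C₁ else C₂
    let big := if C₁.card ≤ C₂.card then C₂ else C₁
    Comp.update fun s => { s with
      unproc := s.unproc ∪ ({small} ×ˢ Finset.univ.filter fun b => D.into small b ≠ ∅) }
    Comp.update fun s => { s with
      unproc := s.unproc ∪
        ({big} ×ˢ Finset.univ.filter fun b => D.into big b ≠ ∅ ∧ (C, b) ∈ s.unproc) }
    Comp.update fun s => { s with unproc := s.unproc \ ({C} ×ˢ Finset.univ) }

open Classical in
/-- The block-splitting part of the abstract algorithm. -/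
noncomputable def abstractMain (D : PTDFA Q A) :
    Comp (AbsState Q A) PUnit.{max u v + 1} := do
  Comp.update fun s => { s with
    blocks := if Finset.univ = D.final then {D.final} else {D.final, Finset.univ \ D.final} }
  Comp.update fun s => { s with
    unproc := (s.blocks ×ˢ Finset.univ).filter fun x => D.into x.1 x.2 ≠ ∅ }
  Comp.whileDo (fun s => s.unproc ≠ ∅) do
    let x ← Comp.choose fun s (x : Finset Q × A) s' => x ∈ s.unproc ∧ s' = s
    Comp.update fun s => { s with unproc := s.unproc \ {x} }
    Comp.forEach (fun s => s.blocks.filter fun C => ∃ q ∈ C, D.Hits x.1 x.2 q)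
      (abstractSplit D x.1 x.2)

end Abstract

/-! ### Refinable partitions -/

/-- The contents of a refinable partition data structure on `{1, …, max}`. Each array has the
indices `1, …, max`; the operations below go wrong if they use any other index. -/
structure RP (max : ℕ) where
  sets : ℕ
  elems : ℕ → ℕ
  loc : ℕ → ℕ
  sidx : ℕ → ℕ
  /-- `first[s]` and `fin[s] - 1` are the first and the last location of set `s`. -/
  first : ℕ → ℕ
  fin : ℕ → ℕ
  /-- The marked elements of set `s` are at the locations `first[s], …, mid[s] - 1`. -/
  mid : ℕ → ℕ

namespace RP

variable {max : ℕ}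

/-- The value of `arr[i]`. -/
def read (arr : RP max → ℕ → ℕ) (i : ℕ) : Comp (RP max) ℕ := do
  Comp.check (1 ≤ i ∧ i ≤ max)
  Comp.query fun r => arr r i

/-- A change of entries with index `i`. -/
def write (i : ℕ) (f : RP max → RP max) : Comp (RP max) Unit := do
  Comp.check (1 ≤ i ∧ i ≤ max)
  Comp.update f

def setElems (i x : ℕ) : Comp (RP max) Unit :=
  write i fun r => { r with elems := Function.update r.elems i x }

def setLoc (i x : ℕ) : Comp (RP max) Unit :=
  write i fun r => { r with loc := Function.update r.loc i x }

def setSidx (i x : ℕ) : Comp (RP max) Unit :=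
  write i fun r => { r with sidx := Function.update r.sidx i x }

def setFirst (i x : ℕ) : Comp (RP max) Unit :=
  write i fun r => { r with first := Function.update r.first i x }

def setFin (i x : ℕ) : Comp (RP max) Unit :=
  write i fun r => { r with fin := Function.update r.fin i x }

def setMid (i x : ℕ) : Comp (RP max) Unit :=
  write i fun r => { r with mid := Function.update r.mid i x }

/-- The operation `Size`. -/
def opSize (s : ℕ) : Comp (RP max) ℕ := do
  let f ← read fin s
  let i ← read first s
  return f - i

/-- The operation `Set`. -/
def opSet (e : ℕ) : Comp (RP max) ℕ :=
  read sidx e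

/-- The operation `First`. -/
def opFirst (s : ℕ) : Comp (RP max) ℕ := do
  let i ← read first s
  read elems i

/-- The operation `Next`. -/
def opNext (e : ℕ) : Comp (RP max) ℕ := do
  let l ← read loc e
  let s ← read sidx e
  let f ← read fin s
  if l + 1 ≥ f then
    return 0
  else
    read elems (l + 1)

/-- The operation `Mark`. -/
def opMark (e : ℕ) : Comp (RP max) Unit := do
  let s ← read sidx e
  let l ← read loc e
  let m ← read mid s
  if l ≥ m then
    let x ← read elems m
    setElems l x
    let y ← read elems l
    setLoc y l
    setElems m e
    setLoc e m
    setMid s (m + 1)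

/-- The operation `Split`. -/
def opSplit (s : ℕ) : Comp (RP max) ℕ := do
  let m ← read mid s
  let f ← read fin s
  if m = f then
    let i ← read first s
    setMid s i
  let m ← read mid s
  let i ← read first s
  if m = i then
    return 0
  else
    Comp.update fun r => { r with sets := r.sets + 1 }
    let new ← Comp.query RP.sets
    setFirst new i
    setMid new i
    setFin new m
    setFirst s m
    let lo ← read first new
    let hi ← read fin new
    Comp.forTo lo (hi - 1) fun l => do
      let e ← read elems l
      setSidx e new
    return new

/-- The operation `No_marks`. -/
def opNoMarks (s : ℕ) : Comp (RP max) Bool := do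
  let m ← read mid s
  let i ← read first s
  return decide (m = i)

/-- The initial contents with a single set; entries that are not mentioned are arbitrary. -/
def IsInitial (r : RP max) : Prop :=
  r.sets = 1 ∧ r.first 1 = 1 ∧ r.mid 1 = 1 ∧ r.fin 1 = max + 1 ∧
    ∀ e, 1 ≤ e → e ≤ max → r.elems e = e ∧ r.loc e = e ∧ r.sidx e = 1

/-- The elements of the set with index `s`. -/
def members (r : RP max) (s : ℕ) : Finset ℕ :=
  (Finset.Ico (r.first s) (r.fin s)).image r.elems

/-- The arrays are consistent: `elems` and `loc` are mutually inverse permutations of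
`{1, …, max}`, the sets `1, …, sets` occupy nonempty intervals of locations, and
`sidx` tells the set of each element. -/
structure WellFormed (r : RP max) : Prop where
  elems_mem : ∀ i ∈ Finset.Icc 1 max, r.elems i ∈ Finset.Icc 1 max
  loc_mem : ∀ e ∈ Finset.Icc 1 max, r.loc e ∈ Finset.Icc 1 max
  loc_elems : ∀ i ∈ Finset.Icc 1 max, r.loc (r.elems i) = i
  elems_loc : ∀ e ∈ Finset.Icc 1 max, r.elems (r.loc e) = e
  range : ∀ s ∈ Finset.Icc 1 r.sets, 1 ≤ r.first s ∧ r.first s < r.fin s ∧ r.fin s ≤ max + 1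
  mid_mem : ∀ s ∈ Finset.Icc 1 r.sets, r.first s ≤ r.mid s ∧ r.mid s ≤ r.fin s
  sidx_mem : ∀ e ∈ Finset.Icc 1 max, r.sidx e ∈ Finset.Icc 1 r.sets
  sidx_eq : ∀ e ∈ Finset.Icc 1 max, ∀ s ∈ Finset.Icc 1 r.sets,
    r.sidx e = s ↔ r.first s ≤ r.loc e ∧ r.loc e < r.fin s

/-- The data structure represents the partition `P`, and no element is marked. -/
def Represents (r : RP max) (P : Finset (Finset ℕ)) : Prop :=
  r.WellFormed ∧ (∀ s ∈ Finset.Icc 1 r.sets, r.mid s = r.first s) ∧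
    (Finset.Icc 1 r.sets).image r.members = P

end RP

/-! ### Simple sets -/

/-- A simple set of numbers: a bag, because `Add` does not check for presence. -/
abbrev SimpleSet := Multiset ℕ

namespace SimpleSet

/-- Adds `i` to a simple set with room for `cap` numbers in the range `1, …, cap`. -/
def opAdd (cap i : ℕ) : Comp SimpleSet Unit where
  run s _ s' := (1 ≤ i ∧ i ≤ cap ∧ Multiset.card s < cap) ∧ s' = i ::ₘ s
  ok s := 1 ≤ i ∧ i ≤ cap ∧ Multiset.card s < cap

/-- Removes and returns an arbitrary number; goes wrong if the set is empty. -/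
def opRemove : Comp SimpleSet ℕ :=
  Comp.choose fun s i s' => i ∈ s ∧ s' = s.erase i

end SimpleSet

/-! ### The concrete algorithm -/

/-- An indexing of the states by `1, …, |Q|` and of the transitions by `1, …, |δ|`. -/
structure Indexing {Q : Type u} {A : Type v} [Fintype Q] (D : PTDFA Q A) where
  state : Q ≃ {i : ℕ // i ∈ Finset.Icc 1 (Fintype.card Q)}
  trans : {x : Q × A × Q // x ∈ D.δ} ≃ {i : ℕ // i ∈ Finset.Icc 1 D.δ.card}

namespace Indexing

variable {Q : Type u} {A : Type v} [Fintype Q] {D : PTDFA Q A}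

/-- The indices of a set of states. -/
def states (e : Indexing D) (S : Finset Q) : Finset ℕ :=
  S.image fun q => (e.state q : ℕ)

/-- The indices of the transitions that belong to `T`. -/
def transitions [DecidableEq Q] [DecidableEq A] (e : Indexing D) (T : Finset (Q × A × Q)) :
    Finset ℕ :=
  (D.δ.attach.filter fun x => x.1 ∈ T).image fun x => (e.trans x : ℕ)

/-- `In_trs[q]`: the indices of the transitions whose head has index `q`. -/
def inTrs (e : Indexing D) (q : ℕ) : Finset ℕ :=
  (D.δ.attach.filter fun x => (e.state x.1.2.2 : ℕ) = q).image fun x => (e.trans x : ℕ)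

end Indexing

/-- The variables of the concrete algorithm, for `n` states and `m` transitions. -/
structure ConcState (n m : ℕ) where
  brp : RP n
  trp : RP m
  unreadySpls : SimpleSet
  touchedBlocks : SimpleSet
  touchedSpls : SimpleSet

namespace ConcState

variable {n m : ℕ} {α : Type}

/-- An operation on `BRP`. -/
def onBRP (c : Comp (RP n) α) : Comp (ConcState n m) α :=
  Comp.zoom brp (fun r s => { s with brp := r }) c

/-- An operation on `TRP`. -/
def onTRP (c : Comp (RP m) α) : Comp (ConcState n m) α :=
  Comp.zoom trp (fun r s => { s with trp := r }) c

/-- An operation on `Unready_Spls`. -/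
def onUnready (c : Comp SimpleSet α) : Comp (ConcState n m) α :=
  Comp.zoom unreadySpls (fun r s => { s with unreadySpls := r }) c

/-- An operation on `Touched_Blocks`. -/
def onTouchedBlocks (c : Comp SimpleSet α) : Comp (ConcState n m) α :=
  Comp.zoom touchedBlocks (fun r s => { s with touchedBlocks := r }) c

/-- An operation on `Touched_Spls`. -/
def onTouchedSpls (c : Comp SimpleSet α) : Comp (ConcState n m) α :=
  Comp.zoom touchedSpls (fun r s => { s with touchedSpls := r }) c

/-- Initially `BRP` consists of one set, the simple sets are empty, and the
contents of `TRP` are arbitrary. -/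
def IsInitial (s : ConcState n m) : Prop :=
  s.brp.IsInitial ∧ s.unreadySpls = 0 ∧ s.touchedBlocks = 0 ∧ s.touchedSpls = 0

end ConcState

section Concrete

open ConcState

variable {Q : Type u} {A : Type v} [Fintype Q] [DecidableEq Q] [Fintype A] [DecidableEq A]
  {D : PTDFA Q A}

/-- The value of `tail[t]`. -/
def readTail (e : Indexing D) (t : ℕ) :
    Comp (ConcState (Fintype.card Q) D.δ.card) ℕ :=
  Comp.choose fun s q s' =>
    (∃ ht : t ∈ Finset.Icc 1 D.δ.card, q = (e.state (e.trans.symm ⟨t, ht⟩).1.1 : ℕ)) ∧ s' = s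

/-- The procedure `Split_block(b)`. -/
def splitBlock (e : Indexing D) (b : ℕ) :
    Comp (ConcState (Fintype.card Q) D.δ.card) Unit := do
  let b₁ ← onBRP (RP.opSplit b)
  if b₁ ≠ 0 then
    let k ← onBRP (RP.opSize b)
    let k₁ ← onBRP (RP.opSize b₁)
    let b' := if k < k₁ then b else b₁
    let q₀ ← onBRP (RP.opFirst b')
    let _ ← Comp.loop q₀ (fun q _ => q ≠ 0) fun q => do
      Comp.forEach (fun _ => e.inTrs q) fun t => do
        let p ← onTRP (RP.opSet t)
        if (← onTRP (RP.opNoMarks p)) then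
          onTouchedSpls (SimpleSet.opAdd D.δ.card p)
        onTRP (RP.opMark t)
      onBRP (RP.opNext q)
    Comp.whileDo (fun s => s.touchedSpls ≠ 0) do
      let p ← onTouchedSpls SimpleSet.opRemove
      let p' ← onTRP (RP.opSplit p)
      if p' ≠ 0 then
        onUnready (SimpleSet.opAdd D.δ.card p')

/-- `Initialize TRP to { δ_{Q,a} | a ∈ Σ ∧ δ_{Q,a} ≠ ∅ }`: the resulting order of the
transitions and the numbering of the sets are arbitrary. -/
def initTRP (e : Indexing D) : Comp (RP D.δ.card) Unit :=
  Comp.choose fun _ _ r' => r'.Represents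
    ((Finset.univ.filter fun a => D.into Finset.univ a ≠ ∅).image
      fun a => e.transitions (D.into Finset.univ a))

/-- The procedure `Main_part`. -/
def mainPart (e : Indexing D) : Comp (ConcState (Fintype.card Q) D.δ.card) Unit := do
  onTRP (initTRP e)
  let k ← Comp.query fun s => s.trp.sets
  Comp.forTo 1 k fun p => onUnready (SimpleSet.opAdd D.δ.card p)
  Comp.forEach (fun _ => e.states D.final) fun q => onBRP (RP.opMark q)
  splitBlock e 1
  Comp.whileDo (fun s => s.unreadySpls ≠ 0) do
    let p ← onUnready SimpleSet.opRemove
    let t₀ ← onTRP (RP.opFirst p)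
    let _ ← Comp.loop t₀ (fun t _ => t ≠ 0) fun t => do
      let q ← readTail e t
      let b' ← onBRP (RP.opSet q)
      if (← onBRP (RP.opNoMarks b')) then
        onTouchedBlocks (SimpleSet.opAdd (Fintype.card Q) b')
      onBRP (RP.opMark q)
      onTRP (RP.opNext t)
    Comp.whileDo (fun s => s.touchedBlocks ≠ 0) do
      let b ← onTouchedBlocks SimpleSet.opRemove
      splitBlock e b

end Concrete

/-!
Let `∼` be the coarsest equivalence of states that respects finality and for which a state with a
transition labelled `a` is related only to states with a transition labelled `a` into the same
class (`PTDFA.Indist`). Both algorithms end with the partition into its classes, `PTDFA.classes`,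
whatever choices they make.

Both are instances of the same partition refinement. All blocks remain unions of `∼`-classes,
because a splitter whose target is a union of `∼`-classes separates no indistinguishable states
(`PTDFA.Indist.hits_iff`). Conversely, the following invariant (`PTDFA.Covered`) holds between the
rounds: if `q` and `q'` are in the same block and `q` has a transition `t` labelled `a`, then `t`
belongs to an unprocessed splitter, or `q'` has a transition labelled `a` that belongs to the same
splitter as `t` or to an unprocessed one. When a block is split, the invariant survives if at least
one of the halves becomes unprocessed (`PTDFA.Covered.split`), and it does not matter which; this is
why the choice of the smaller half is correct. When no splitter is unprocessed, the invariant says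
that the current equivalence is stable, hence equal to `∼` (`PTDFA.Covered.iff_indist`).

For the concrete algorithm, the sets of `TRP` are kept equal to the splitters, the nonempty sets of
transitions with a common label into a common block. `Split_block` restores this relation after
splitting a block: it marks the transitions into one of the two parts and splits the sets of `TRP`
by the marks (`wp_splitBlock`). The new sets become unprocessed, and they are the halves that
`PTDFA.Covered.split` needs. Simple sets contain only different indices of sets, and a partition of
`{1, …, max}` has at most `max` sets, so they never overflow.

Termination of the abstract algorithm holds because a round either increases the number of blocks or
decreases the number of unprocessed splitters. In the concrete algorithm the number of sets of `TRP`
minus the number of unprocessed ones increases in every round.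

Programs are treated with a total-correctness calculus (`Comp.Wp`) whose assertions include the
existence of an execution. In particular, the existence of initial contents of `TRP` is obtained by
running `Mark` and `Split` for one label after the other (`RP.exists_sidx_eq_iff`).
-/

/-! ### Total correctness of nondeterministic computations -/

namespace Comp

section Rules

variable {σ : Type u} {τ : Type w} {α β : Type v}

/-- Total correctness of `c` started in `s`, together with the existence of an execution:
the analogue of `Guarantees` for computations that return a value. -/
def Wp (c : Comp σ α) (s : σ) (post : α → σ → Prop) : Prop :=
  c.ok s ∧ (∃ a s', c.run s a s') ∧ ∀ a s', c.run s a s' → post a s'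

theorem Wp.mono {c : Comp σ α} {s : σ} {p p' : α → σ → Prop} (h : Wp c s p)
    (hp : ∀ a s', p a s' → p' a s') : Wp c s p' :=
  ⟨h.1, h.2.1, fun a s' hr => hp a s' (h.2.2 a s' hr)⟩

theorem guarantees_of_wp {c : Comp σ PUnit.{v + 1}} {s : σ} {post : σ → Prop}
    (h : Wp c s fun _ s' => post s') : c.Guarantees s post :=
  ⟨h.1, let ⟨_, s', hr⟩ := h.2.1; ⟨s', hr⟩, fun s' hr => h.2.2 _ s' hr⟩

theorem wp_pure {a : α} {s : σ} {post : α → σ → Prop} :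
    Wp (pure a : Comp σ α) s post ↔ post a s := by
  constructor
  · intro h
    exact h.2.2 a s ⟨rfl, rfl⟩
  · intro h
    refine ⟨trivial, ⟨a, s, rfl, rfl⟩, ?_⟩
    rintro b s' ⟨rfl, rfl⟩
    exact h

theorem wp_bind {c : Comp σ α} {f : α → Comp σ β} {s : σ} {post : β → σ → Prop}
    (h : Wp c s fun a s' => Wp (f a) s' post) : Wp (c >>= f) s post := by
  obtain ⟨hok, ⟨a, s', hr⟩, hall⟩ := h
  refine ⟨⟨hok, fun a s' hr => (hall a s' hr).1⟩, ?_, ?_⟩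
  · obtain ⟨b, s'', hr'⟩ := (hall a s' hr).2.1
    exact ⟨b, s'', a, s', hr, hr'⟩
  · rintro b s'' ⟨a, s', hr, hr'⟩
    exact (hall a s' hr).2.2 b s'' hr'

/-- `wp_bind` with the specification of the first computation given separately. -/
theorem Wp.bind {c : Comp σ α} {f : α → Comp σ β} {s : σ} {mid : α → σ → Prop}
    {post : β → σ → Prop} (h : Wp c s mid) (hf : ∀ a s', mid a s' → Wp (f a) s' post) :
    Wp (c >>= f) s post :=
  wp_bind (h.mono hf)

theorem wp_query_bind {g : σ → α} {f : α → Comp σ β} {s : σ} {post : β → σ → Prop} :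
    Wp (query g >>= f) s post ↔ Wp (f (g s)) s post := by
  constructor
  · rintro ⟨hok, ⟨b, s', a, s'', ⟨rfl, rfl⟩, hr⟩, hall⟩
    exact ⟨hok.2 _ _ ⟨rfl, rfl⟩, ⟨b, s', hr⟩, fun b s' hr => hall b s' ⟨_, _, ⟨rfl, rfl⟩, hr⟩⟩
  · intro h
    refine wp_bind ⟨trivial, ⟨_, _, rfl, rfl⟩, ?_⟩
    rintro a s' ⟨rfl, rfl⟩
    exact h

theorem wp_update {g : σ → σ} {s : σ} {post : PUnit.{v + 1} → σ → Prop} :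
    Wp (update g) s post ↔ post PUnit.unit (g s) := by
  constructor
  · intro h
    exact h.2.2 _ _ rfl
  · intro h
    refine ⟨trivial, ⟨PUnit.unit, g s, rfl⟩, ?_⟩
    rintro a s' rfl
    exact h

theorem wp_update_bind {g : σ → σ} {f : PUnit.{v + 1} → Comp σ β} {s : σ}
    {post : β → σ → Prop} :
    Wp (update g >>= f) s post ↔ Wp (f PUnit.unit) (g s) post := by
  constructor
  · rintro ⟨hok, ⟨b, s', a, s'', rfl, hr⟩, hall⟩
    exact ⟨hok.2 _ _ rfl, ⟨b, s', hr⟩, fun b s' hr => hall b s' ⟨_, _, rfl, hr⟩⟩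
  · intro h
    exact wp_bind (wp_update.2 h)

theorem wp_choose {r : σ → α → σ → Prop} {s : σ} {post : α → σ → Prop}
    (hex : ∃ a s', r s a s') (h : ∀ a s', r s a s' → post a s') : Wp (choose r) s post :=
  ⟨hex, hex, h⟩

theorem wp_zoom {proj : σ → τ} {put : τ → σ → σ} {c : Comp τ α} {s : σ}
    {post : α → σ → Prop} (h : Wp c (proj s) fun a r => post a (put r s)) :
    Wp (zoom proj put c) s post := by
  obtain ⟨hok, ⟨a, r, hr⟩, hall⟩ := h
  refine ⟨hok, ⟨a, _, r, hr, rfl⟩, ?_⟩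
  rintro a s' ⟨r, hr, rfl⟩
  exact hall a r hr

/-- The rule for loops: an invariant, and a variant in a well-founded order. -/
theorem wp_loop {γ : Type*} [Preorder γ] [WellFoundedLT γ] {cond : β → σ → Prop}
    {body : β → Comp σ β} (inv : β → σ → Prop) (μ : β → σ → γ)
    (hstep : ∀ x s, inv x s → cond x s →
      Wp (body x) s fun y s' => inv y s' ∧ μ y s' < μ x s)
    {post : β → σ → Prop} (hpost : ∀ x s, inv x s → ¬ cond x s → post x s)
    {x₀ : β} {s : σ} (h₀ : inv x₀ s) : Wp (loop x₀ cond body) s post := by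
  have key : ∀ (n : γ) (x : β) (s : σ), μ x s = n → inv x s →
      LoopOk cond body x s ∧ (∃ y s', LoopRun cond body x s y s') := by
    intro n
    induction n using WellFoundedLT.induction with
    | ind n ih =>
      rintro x s rfl hx
      by_cases hc : cond x s
      · obtain ⟨hok, ⟨y, s', hr⟩, hall⟩ := hstep x s hx hc
        refine ⟨.step hc hok fun y s' hr => ?_, ?_⟩
        · exact (ih _ (hall y s' hr).2 y s' rfl (hall y s' hr).1).1
        · obtain ⟨z, s'', hz⟩ := (ih _ (hall y s' hr).2 y s' rfl (hall y s' hr).1).2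
          exact ⟨z, s'', .step hc hr hz⟩
      · exact ⟨.done hc, x, s, .done hc⟩
  refine ⟨(key _ x₀ s rfl h₀).1, (key _ x₀ s rfl h₀).2, ?_⟩
  intro y s' hr
  have hr' : LoopRun cond body x₀ s y s' := hr
  clear hr
  induction hr' with
  | done hc => exact hpost _ _ h₀ hc
  | step hc hr _ ih => exact ih ((hstep _ _ h₀ hc).2.2 _ _ hr).1

theorem wp_whileDo {γ : Type*} [Preorder γ] [WellFoundedLT γ] {cond : σ → Prop}
    {body : Comp σ PUnit.{v + 1}} (inv : σ → Prop) (μ : σ → γ)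
    (hstep : ∀ s, inv s → cond s → Wp body s fun _ s' => inv s' ∧ μ s' < μ s)
    {post : PUnit.{v + 1} → σ → Prop}
    (hpost : ∀ s, inv s → ¬ cond s → post PUnit.unit s)
    {s : σ} (h₀ : inv s) : Wp (whileDo cond body) s post :=
  wp_loop (fun _ s => inv s) (fun _ s => μ s) (fun _ s => hstep s)
    (fun _ s hs hc => hpost s hs hc) h₀

/-- The rule for loops over a list; the invariant depends on the part that is still to come. -/
theorem wp_forList {ι : Type w} {body : ι → Comp σ PUnit.{v + 1}} (inv : List ι → σ → Prop)
    (hstep : ∀ x l s, inv (x :: l) s → Wp (body x) s fun _ s' => inv l s')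
    {post : PUnit.{v + 1} → σ → Prop} (hpost : ∀ s, inv [] s → post PUnit.unit s)
    {l : List ι} {s : σ} (h₀ : inv l s) : Wp (forList body l) s post := by
  induction l generalizing s with
  | nil => exact wp_pure.2 (hpost s h₀)
  | cons x l ih => exact (hstep x l s h₀).bind fun _ s' h => ih h

theorem wp_forEach {ι : Type w} {S : σ → Finset ι} {body : ι → Comp σ PUnit.{v + 1}}
    (inv : List ι → σ → Prop)
    (hstep : ∀ x l s, inv (x :: l) s → Wp (body x) s fun _ s' => inv l s')
    {post : PUnit.{v + 1} → σ → Prop} (hpost : ∀ s, inv [] s → post PUnit.unit s)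
    {s : σ} (h₀ : ∀ l : List ι, l.Nodup → (∀ x, x ∈ l ↔ x ∈ S s) → inv l s) :
    Wp (forEach S body) s post := by
  have key : ∀ l : List ι, l.Nodup → (∀ x, x ∈ l ↔ x ∈ S s) → Wp (forList body l) s post :=
    fun l hl hmem => wp_forList inv hstep hpost (h₀ l hl hmem)
  refine ⟨fun l hl hmem => (key l hl hmem).1, ?_, ?_⟩
  · have hn : (S s).toList.Nodup := (S s).nodup_toList
    have hm : ∀ x, x ∈ (S s).toList ↔ x ∈ S s := fun x => Finset.mem_toList
    obtain ⟨a, s', hr⟩ := (key _ hn hm).2.1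
    exact ⟨a, s', _, hn, hm, hr⟩
  · rintro a s' ⟨l, hl, hmem, hr⟩
    exact (key l hl hmem).2.2 a s' hr

end Rules

end Comp

/-! ### Operations on refinable partitions -/

namespace RP

open Comp

variable {max : ℕ}

theorem wp_read {arr : RP max → ℕ → ℕ} {i : ℕ} {r : RP max} {post : ℕ → RP max → Prop} :
    Wp (read arr i) r post ↔ (1 ≤ i ∧ i ≤ max) ∧ post (arr r i) r := by
  constructor
  · rintro ⟨hok, _, hall⟩
    exact ⟨hok.1, hall _ _ ⟨PUnit.unit, r, ⟨hok.1, rfl⟩, rfl, rfl⟩⟩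
  · rintro ⟨hi, h⟩
    refine ⟨⟨hi, fun _ _ _ => trivial⟩, ⟨_, r, PUnit.unit, r, ⟨hi, rfl⟩, rfl, rfl⟩, ?_⟩
    rintro a r' ⟨_, _, ⟨_, rfl⟩, rfl, rfl⟩
    exact h

theorem wp_read_bind {α : Type} {arr : RP max → ℕ → ℕ} {i : ℕ} {f : ℕ → Comp (RP max) α}
    {r : RP max} {post : α → RP max → Prop} :
    Wp (read arr i >>= f) r post ↔ (1 ≤ i ∧ i ≤ max) ∧ Wp (f (arr r i)) r post := by
  constructor
  · rintro ⟨hok, ⟨b, r', a, r'', ⟨_, _, ⟨hi, rfl⟩, rfl, rfl⟩, hr⟩, hall⟩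
    exact ⟨hi, hok.2 _ _ ⟨PUnit.unit, _, ⟨hi, rfl⟩, rfl, rfl⟩, ⟨b, r', hr⟩,
      fun b r' hr => hall b r' ⟨_, _, ⟨PUnit.unit, _, ⟨hi, rfl⟩, rfl, rfl⟩, hr⟩⟩
  · rintro ⟨hi, h⟩
    exact wp_bind (wp_read.2 ⟨hi, h⟩)

theorem wp_write {i : ℕ} {g : RP max → RP max} {r : RP max} {post : Unit → RP max → Prop} :
    Wp (write i g) r post ↔ (1 ≤ i ∧ i ≤ max) ∧ post () (g r) := by
  constructor
  · rintro ⟨hok, _, hall⟩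
    exact ⟨hok.1, hall _ _ ⟨PUnit.unit, r, ⟨hok.1, rfl⟩, rfl⟩⟩
  · rintro ⟨hi, h⟩
    refine ⟨⟨hi, fun _ _ _ => trivial⟩, ⟨(), _, PUnit.unit, r, ⟨hi, rfl⟩, rfl⟩, ?_⟩
    rintro a r' ⟨_, _, ⟨_, rfl⟩, rfl⟩
    exact h

theorem wp_write_bind {α : Type} {i : ℕ} {g : RP max → RP max} {f : Unit → Comp (RP max) α}
    {r : RP max} {post : α → RP max → Prop} :
    Wp (write i g >>= f) r post ↔ (1 ≤ i ∧ i ≤ max) ∧ Wp (f ()) (g r) post := by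
  constructor
  · rintro ⟨hok, ⟨b, r', a, r'', ⟨_, _, ⟨hi, rfl⟩, rfl⟩, hr⟩, hall⟩
    exact ⟨hi, hok.2 _ _ ⟨PUnit.unit, _, ⟨hi, rfl⟩, rfl⟩, ⟨b, r', hr⟩,
      fun b r' hr => hall b r' ⟨_, _, ⟨PUnit.unit, _, ⟨hi, rfl⟩, rfl⟩, hr⟩⟩
  · rintro ⟨hi, h⟩
    exact wp_bind (wp_write.2 ⟨hi, h⟩)

/-- The element `e` is marked. -/
def Marked (r : RP max) (e : ℕ) : Prop :=
  r.loc e < r.mid (r.sidx e)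

theorem WellFormed.sidx_elems {r : RP max} (h : r.WellFormed) {s i : ℕ}
    (hs : s ∈ Finset.Icc 1 r.sets) (h₁ : r.first s ≤ i) (h₂ : i < r.fin s) :
    i ∈ Finset.Icc 1 max ∧ r.sidx (r.elems i) = s := by
  have hr := h.range s hs
  have hi : i ∈ Finset.Icc 1 max := by
    rw [Finset.mem_Icc]
    omega
  refine ⟨hi, (h.sidx_eq _ (h.elems_mem i hi) s hs).2 ?_⟩
  rw [h.loc_elems i hi]
  exact ⟨h₁, h₂⟩

theorem WellFormed.loc_bounds {r : RP max} (h : r.WellFormed) {e : ℕ}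
    (he : e ∈ Finset.Icc 1 max) : r.first (r.sidx e) ≤ r.loc e ∧ r.loc e < r.fin (r.sidx e) :=
  (h.sidx_eq e he _ (h.sidx_mem e he)).1 rfl

theorem WellFormed.sets_le {r : RP max} (h : r.WellFormed) : r.sets ≤ max := by
  have hc := Finset.card_le_card_of_injOn (s := Finset.Icc 1 r.sets) (t := Finset.Icc 1 max)
    r.first (fun s hs => (h.sidx_elems hs le_rfl (h.range s hs).2.1).1) (by
      intro s hs s' hs' heq
      rw [← (h.sidx_elems hs le_rfl (h.range s hs).2.1).2, heq,
        (h.sidx_elems hs' le_rfl (h.range s' hs').2.1).2])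
  simpa using hc

/-- There is room for one more set if some set can be split. -/
theorem WellFormed.sets_lt {r : RP max} (h : r.WellFormed) {s i : ℕ}
    (hs : s ∈ Finset.Icc 1 r.sets) (h₁ : r.first s < i) (h₂ : i < r.fin s) : r.sets < max := by
  have hi := h.sidx_elems hs h₁.le h₂
  have hc := Finset.card_le_card_of_injOn (s := Finset.Icc 1 r.sets)
    (t := (Finset.Icc 1 max).erase i) r.first
    (fun k hk => by
      have hk' := h.sidx_elems hk le_rfl (h.range k hk).2.1
      refine Finset.mem_coe.2 (Finset.mem_erase.2 ⟨?_, hk'.1⟩)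
      rintro rfl
      have : k = s := hk'.2.symm.trans hi.2
      subst this
      exact lt_irrefl _ h₁) (by
      intro k hk k' hk' heq
      rw [← (h.sidx_elems hk le_rfl (h.range k hk).2.1).2, heq,
        (h.sidx_elems hk' le_rfl (h.range k' hk').2.1).2])
  rw [Finset.card_erase_of_mem hi.1] at hc
  have := Finset.mem_Icc.1 hi.1
  simp only [Nat.card_Icc] at hc
  omega

theorem WellFormed.mem_members {r : RP max} (h : r.WellFormed) {s x : ℕ}
    (hs : s ∈ Finset.Icc 1 r.sets) :
    x ∈ r.members s ↔ x ∈ Finset.Icc 1 max ∧ r.sidx x = s := by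
  simp only [members, Finset.mem_image, Finset.mem_Ico]
  constructor
  · rintro ⟨i, ⟨h₁, h₂⟩, rfl⟩
    obtain ⟨hi, hsi⟩ := h.sidx_elems hs h₁ h₂
    exact ⟨h.elems_mem i hi, hsi⟩
  · rintro ⟨hx, rfl⟩
    exact ⟨r.loc x, h.loc_bounds hx, h.elems_loc x hx⟩

theorem WellFormed.mid_eq_first_iff {r : RP max} (h : r.WellFormed) {s : ℕ}
    (hs : s ∈ Finset.Icc 1 r.sets) :
    r.mid s = r.first s ↔ ∀ x ∈ Finset.Icc 1 max, r.sidx x = s → ¬ r.Marked x := by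
  have hm := h.mid_mem s hs
  have hr := h.range s hs
  constructor
  · rintro heq x hx rfl hmk
    have := h.loc_bounds hx
    unfold Marked at hmk
    omega
  · intro hall
    by_contra hne
    obtain ⟨hi, hsi⟩ := h.sidx_elems hs le_rfl hr.2.1
    apply hall _ (h.elems_mem _ hi) hsi
    unfold Marked
    rw [hsi, h.loc_elems _ hi]
    omega

theorem WellFormed.exists_mem {r : RP max} (h : r.WellFormed) {s : ℕ}
    (hs : s ∈ Finset.Icc 1 r.sets) : ∃ x ∈ Finset.Icc 1 max, r.sidx x = s :=
  let ⟨hi, hsi⟩ := h.sidx_elems hs le_rfl (h.range s hs).2.1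
  ⟨_, h.elems_mem _ hi, hsi⟩

theorem WellFormed.index_bounds {r : RP max} (h : r.WellFormed) {s : ℕ}
    (hs : s ∈ Finset.Icc 1 r.sets) : 1 ≤ s ∧ s ≤ max :=
  ⟨(Finset.mem_Icc.1 hs).1, (Finset.mem_Icc.1 hs).2.trans h.sets_le⟩

theorem wp_opSet {r : RP max} {e : ℕ} (he : e ∈ Finset.Icc 1 max) :
    Wp (opSet e) r fun s r' => s = r.sidx e ∧ r' = r :=
  wp_read.2 ⟨Finset.mem_Icc.1 he, rfl, rfl⟩

theorem wp_opNoMarks {r : RP max} (h : r.WellFormed) {s : ℕ} (hs : s ∈ Finset.Icc 1 r.sets) :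
    Wp (opNoMarks s) r fun a r' =>
      (a = true ↔ ∀ x ∈ Finset.Icc 1 max, r.sidx x = s → ¬ r.Marked x) ∧ r' = r := by
  simp only [opNoMarks, wp_read_bind, wp_pure]
  refine ⟨h.index_bounds hs, h.index_bounds hs, ?_, trivial⟩
  rw [decide_eq_true_iff, h.mid_eq_first_iff hs]

theorem wp_opSize {r : RP max} (h : r.WellFormed) {s : ℕ} (hs : s ∈ Finset.Icc 1 r.sets) :
    Wp (opSize s) r fun _ r' => r' = r := by
  simp only [opSize, wp_read_bind, wp_pure]
  exact ⟨h.index_bounds hs, h.index_bounds hs, trivial⟩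

theorem wp_opFirst {r : RP max} (h : r.WellFormed) {s : ℕ} (hs : s ∈ Finset.Icc 1 r.sets) :
    Wp (opFirst s) r fun q r' => q = r.elems (r.first s) ∧ r' = r := by
  simp only [opFirst, wp_read_bind, wp_read]
  exact ⟨h.index_bounds hs,
    Finset.mem_Icc.1 (h.sidx_elems hs le_rfl (h.range s hs).2.1).1, trivial, trivial⟩

/-- The value of `Next(e)`. -/
def next (r : RP max) (e : ℕ) : ℕ :=
  if r.loc e + 1 ≥ r.fin (r.sidx e) then 0 else r.elems (r.loc e + 1)

theorem wp_opNext {r : RP max} (h : r.WellFormed) {e : ℕ} (he : e ∈ Finset.Icc 1 max) :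
    Wp (opNext e) r fun q r' => q = r.next e ∧ r' = r := by
  simp only [opNext, wp_read_bind]
  refine ⟨Finset.mem_Icc.1 he, Finset.mem_Icc.1 he, h.index_bounds (h.sidx_mem e he), ?_⟩
  unfold next
  split_ifs with hc
  · exact wp_pure.2 ⟨rfl, rfl⟩
  · refine wp_read.2 ⟨?_, rfl, rfl⟩
    have := h.range _ (h.sidx_mem e he)
    omega

theorem wp_opMark {r : RP max} (h : r.WellFormed) {e : ℕ} (he : e ∈ Finset.Icc 1 max) :
    Wp (opMark e) r fun _ r' => r'.WellFormed ∧ r'.sets = r.sets ∧ r'.sidx = r.sidx ∧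
      ∀ x ∈ Finset.Icc 1 max, r'.Marked x ↔ r.Marked x ∨ x = e := by
  have hs := h.sidx_mem e he
  have hb := h.loc_bounds he
  have hm := h.mid_mem _ hs
  have hr := h.range _ hs
  have hl := h.loc_mem e he
  simp only [opMark, setElems, setLoc, setMid, wp_read_bind]
  refine ⟨Finset.mem_Icc.1 he, Finset.mem_Icc.1 he, h.index_bounds hs, ?_⟩
  split_ifs with hc
  · obtain ⟨s, hse⟩ : ∃ s, s = r.sidx e := ⟨_, rfl⟩
    obtain ⟨m, hme⟩ : ∃ m, m = r.mid s := ⟨_, rfl⟩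
    obtain ⟨l, hle⟩ : ∃ l, l = r.loc e := ⟨_, rfl⟩
    rw [← hse, ← hle] at hb
    rw [← hle] at hl
    rw [← hse] at hs hm hr
    rw [← hse, ← hle, ← hme] at hc
    simp only [wp_read_bind, wp_write_bind, wp_write, Function.update_self, ← hse, ← hle, ← hme]
    have hmm : m ∈ Finset.Icc 1 max := by
      rw [Finset.mem_Icc]
      omega
    have hxm := h.elems_mem m hmm
    have hsm : r.sidx (r.elems m) = s := (h.sidx_elems hs (by omega) (by omega)).2
    have hel : r.elems l = e := by rw [hle]; exact h.elems_loc e he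
    have hlm : r.loc (r.elems m) = m := h.loc_elems m hmm
    refine ⟨Finset.mem_Icc.1 hmm, Finset.mem_Icc.1 hl, Finset.mem_Icc.1 hl,
      Finset.mem_Icc.1 hxm, Finset.mem_Icc.1 hmm, Finset.mem_Icc.1 he, h.index_bounds hs, ?_,
      trivial, trivial, ?_⟩
    · have h1 := h.elems_mem
      have h2 := h.loc_mem
      have h3 := h.loc_elems
      have h4 := h.elems_loc
      constructor
      · intro i hi
        grind
      · intro i hi
        grind
      · intro i hi
        grind
      · intro i hi
        grind
      · exact h.range
      · intro k hk
        have := h.mid_mem k hk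
        grind
      · exact h.sidx_mem
      · intro x hx k hk
        have h5 := h.sidx_eq x hx k hk
        have h6 := h.sidx_eq e he k hk
        have h7 := h.sidx_eq _ hxm k hk
        grind
    · intro x hx
      have h4 := h.elems_loc x hx
      have h5 := h.loc_bounds hx
      unfold Marked
      dsimp only
      grind
  · refine wp_pure.2 ⟨h, rfl, rfl, fun x _ => ⟨Or.inl, ?_⟩⟩
    rintro (hx | rfl)
    · exact hx
    · exact not_le.1 hc

/-- `Split(s)` separates the marked elements of `s` from the others, unless there are none of
one kind, and removes the marks of `s`. -/
theorem wp_opSplit {r : RP max} (h : r.WellFormed) {s : ℕ} (hs : s ∈ Finset.Icc 1 r.sets) :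
    Wp (opSplit s) r fun k r' => r'.WellFormed ∧
      (∀ x ∈ Finset.Icc 1 max, r'.Marked x ↔ r.Marked x ∧ r.sidx x ≠ s) ∧
      ((k = 0 ∧ r'.sets = r.sets ∧ r'.sidx = r.sidx ∧
          ∀ x ∈ Finset.Icc 1 max, ∀ y ∈ Finset.Icc 1 max, r.sidx x = s → r.sidx y = s →
            (r.Marked x ↔ r.Marked y)) ∨
        (k = r.sets + 1 ∧ r'.sets = r.sets + 1 ∧
          ∀ x ∈ Finset.Icc 1 max,
            (r.sidx x = s → r.Marked x → r'.sidx x = k) ∧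
            (¬ (r.sidx x = s ∧ r.Marked x) → r'.sidx x = r.sidx x))) := by
  have hr := h.range s hs
  have hm := h.mid_mem s hs
  have hsb := h.index_bounds hs
  simp only [opSplit, setMid, setFirst, setFin, setSidx, wp_read_bind]
  refine ⟨hsb, hsb, ?_⟩
  split_ifs with hc
  · simp only [wp_read_bind, wp_write_bind, Function.update_self, if_true, wp_pure]
    refine ⟨hsb, hsb, hsb, hsb, ?_, ?_, .inl ⟨trivial, trivial, trivial, ?_⟩⟩
    · constructor
      · exact h.elems_mem
      · exact h.loc_mem
      · exact h.loc_elems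
      · exact h.elems_loc
      · exact h.range
      · intro k hk
        have := h.mid_mem k hk
        grind
      · exact h.sidx_mem
      · exact h.sidx_eq
    · intro x hx
      have := h.loc_bounds hx
      unfold Marked
      dsimp only
      grind
    · intro x hx y hy hxs hys
      have h1 := h.loc_bounds hx
      have h2 := h.loc_bounds hy
      unfold Marked
      grind
  · simp only [wp_read_bind]
    refine ⟨hsb, hsb, ?_⟩
    split_ifs with hc'
    · refine wp_pure.2 ⟨h, ?_, .inl ⟨rfl, rfl, rfl, ?_⟩⟩
      · intro x hx
        have := h.loc_bounds hx
        unfold Marked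
        grind
      · intro x hx y hy hxs hys
        have h1 := h.loc_bounds hx
        have h2 := h.loc_bounds hy
        unfold Marked
        grind
    · have hlt : r.sets < max := h.sets_lt hs (i := r.mid s) (by omega) (by omega)
      have hn : 1 ≤ r.sets + 1 ∧ r.sets + 1 ≤ max := by omega
      have hne : s ≠ r.sets + 1 := by
        have := Finset.mem_Icc.1 hs
        omega
      simp only [wp_read_bind, wp_write_bind, wp_update_bind, wp_query_bind,
        Function.update_self, Function.update_of_ne hne.symm]
      refine ⟨hn, hn, hn, hsb, hn, hn, ?_⟩
      -- The loop changes nothing but `sidx`, at the locations of the formerly marked elements.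
      refine Wp.bind (mid := fun _ r' => ∃ f, r' = RP.mk (r.sets + 1) r.elems r.loc f
          (Function.update (Function.update r.first (r.sets + 1) (r.first s)) s (r.mid s))
          (Function.update r.fin (r.sets + 1) (r.mid s))
          (Function.update r.mid (r.sets + 1) (r.first s)) ∧
        ∀ x ∈ Finset.Icc 1 max,
          (r.first s ≤ r.loc x → r.loc x < r.mid s → f x = r.sets + 1) ∧
          (¬ (r.first s ≤ r.loc x ∧ r.loc x < r.mid s) → f x = r.sidx x)) ?_ ?_
      · unfold forTo
        refine wp_forList (fun l r' => (∀ i ∈ l, r.first s ≤ i ∧ i < r.mid s) ∧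
          ∃ f, r' = RP.mk (r.sets + 1) r.elems r.loc f
            (Function.update (Function.update r.first (r.sets + 1) (r.first s)) s (r.mid s))
            (Function.update r.fin (r.sets + 1) (r.mid s))
            (Function.update r.mid (r.sets + 1) (r.first s)) ∧
          ∀ x ∈ Finset.Icc 1 max,
            (r.first s ≤ r.loc x → r.loc x < r.mid s → r.loc x ∉ l → f x = r.sets + 1) ∧
            (¬ (r.first s ≤ r.loc x ∧ r.loc x < r.mid s) → f x = r.sidx x)) ?_ ?_ ?_
        · rintro i l _ ⟨hl, f, rfl, hf⟩
          have hi := hl i List.mem_cons_self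
          have hii := (h.sidx_elems hs hi.1 (by omega)).1
          have he := h.elems_mem i hii
          have hle := h.loc_elems i hii
          simp only [wp_read_bind, wp_write]
          refine ⟨Finset.mem_Icc.1 hii, Finset.mem_Icc.1 he,
            fun j hj => hl j (List.mem_cons_of_mem _ hj), _, rfl, ?_⟩
          intro x hx
          have hxl := h.elems_loc x hx
          have hfx := hf x hx
          grind
        · rintro _ ⟨-, f, rfl, hf⟩
          refine ⟨f, rfl, fun x hx => ⟨fun h₁ h₂ => (hf x hx).1 h₁ h₂ ?_, (hf x hx).2⟩⟩
          simp
        · refine ⟨?_, r.sidx, rfl, fun x _ => ⟨?_, fun _ => rfl⟩⟩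
          · intro i hi
            rw [List.mem_range'_1] at hi
            omega
          · intro h₁ h₂ h₃
            exfalso
            apply h₃
            rw [List.mem_range'_1]
            omega
      · rintro _ _ ⟨f, rfl, hf⟩
        refine wp_pure.2 ?_
        have hb : ∀ x ∈ Finset.Icc 1 max, r.sidx x ≠ r.sets + 1 := by
          intro x hx
          have := Finset.mem_Icc.1 (h.sidx_mem x hx)
          omega
        have hfx : ∀ x ∈ Finset.Icc 1 max, f x =
            if r.sidx x = s ∧ r.loc x < r.mid s then r.sets + 1 else r.sidx x := by
          intro x hx
          have h1 := hf x hx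
          have h2 := h.sidx_eq x hx s hs
          grind
        refine ⟨?_, ?_, .inr ⟨rfl, rfl, ?_⟩⟩
        · constructor
          · exact h.elems_mem
          · exact h.loc_mem
          · exact h.loc_elems
          · exact h.elems_loc
          · intro k hk
            dsimp only at hk ⊢
            rw [Finset.mem_Icc] at hk
            have := h.range k
            rw [Finset.mem_Icc] at this
            grind
          · intro k hk
            dsimp only at hk ⊢
            rw [Finset.mem_Icc] at hk
            have := h.mid_mem k
            rw [Finset.mem_Icc] at this
            grind
          · intro x hx
            have := h.sidx_mem x hx
            dsimp only
            rw [Finset.mem_Icc] at this ⊢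
            grind
          · intro x hx k hk
            dsimp only at hk ⊢
            have h0 := hb x hx
            have h1 := h.sidx_eq x hx k
            have h2 := h.sidx_eq x hx s hs
            have h3 := hfx x hx
            rw [Finset.mem_Icc] at hk h1
            grind
        · intro x hx
          have h0 := hb x hx
          have h1 := h.loc_bounds hx
          have h3 := hfx x hx
          unfold Marked
          dsimp only
          grind
        · intro x hx
          have h3 := hfx x hx
          unfold Marked
          dsimp only
          grind

/-- `r'` arises from `r` by a call of `Split(s)` that returns `k`. -/
structure IsSplit (r r' : RP max) (s k : ℕ) : Prop where
  wf : r'.WellFormed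
  marked : ∀ x ∈ Finset.Icc 1 max, r'.Marked x ↔ r.Marked x ∧ r.sidx x ≠ s
  same_set : ∀ x ∈ Finset.Icc 1 max, ∀ y ∈ Finset.Icc 1 max,
    r'.sidx x = r'.sidx y ↔ r.sidx x = r.sidx y ∧ (r.sidx x = s → (r.Marked x ↔ r.Marked y))
  of_ne : ∀ x ∈ Finset.Icc 1 max, r.sidx x ≠ s → r'.sidx x = r.sidx x
  of_unmarked : ∀ x ∈ Finset.Icc 1 max, ¬ r.Marked x → r'.sidx x = r.sidx x
  of_eq_zero : k = 0 → r'.sets = r.sets ∧ r'.sidx = r.sidx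
  of_ne_zero : k ≠ 0 → k = r.sets + 1 ∧ r'.sets = r.sets + 1 ∧
    ∀ x ∈ Finset.Icc 1 max, r.sidx x = s → r.Marked x → r'.sidx x = k

theorem wp_opSplit_isSplit {r : RP max} (h : r.WellFormed) {s : ℕ}
    (hs : s ∈ Finset.Icc 1 r.sets) : Wp (opSplit s) r fun k r' => r.IsSplit r' s k := by
  refine (wp_opSplit h hs).mono ?_
  rintro k r' ⟨hwf, hmk, ⟨rfl, hsets, hsidx, hall⟩ | ⟨rfl, hsets, hall⟩⟩
  · refine ⟨hwf, hmk, ?_, fun x _ _ => by rw [hsidx], fun x _ _ => by rw [hsidx],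
      fun _ => ⟨hsets, hsidx⟩, fun h => absurd rfl h⟩
    intro x hx y hy
    rw [hsidx]
    exact ⟨fun heq => ⟨heq, fun hxs => hall x hx y hy hxs (heq ▸ hxs)⟩, And.left⟩
  · refine ⟨hwf, hmk, ?_, fun x hx hne => (hall x hx).2 fun hh => hne hh.1,
      fun x hx hne => (hall x hx).2 fun hh => hne hh.2, fun h => by omega,
      fun _ => ⟨rfl, hsets, fun x hx => (hall x hx).1⟩⟩
    intro x hx y hy
    have h1 := Finset.mem_Icc.1 (h.sidx_mem x hx)
    have h2 := Finset.mem_Icc.1 (h.sidx_mem y hy)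
    have h3 := hall x hx
    have h4 := hall y hy
    grind

/-! ### Traversing a set -/

/-- The loop `q := First(s); while q ≠ 0 do … q := Next(q)` visits every element of `s` once,
provided that the body returns the successor with respect to the fixed contents `r`. -/
theorem wp_traverse {σ : Type u} {r : RP max} (h : r.WellFormed) {s : ℕ}
    (hs : s ∈ Finset.Icc 1 r.sets) {body : ℕ → Comp σ ℕ} (inv : Finset ℕ → σ → Prop)
    (hstep : ∀ visited q c, inv visited c → q ∈ Finset.Icc 1 max → r.sidx q = s → q ∉ visited →
      Wp (body q) c fun q' c' => q' = r.next q ∧ inv (insert q visited) c')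
    {post : ℕ → σ → Prop}
    (hpost : ∀ q c, inv {x ∈ Finset.Icc 1 max | r.sidx x = s} c → post q c)
    {c : σ} (h₀ : inv ∅ c) :
    Wp (loop (r.elems (r.first s)) (fun q _ => q ≠ 0) body) c post := by
  have hr := h.range s hs
  refine wp_loop (γ := ℕ) (fun q c =>
      (q ∈ Finset.Icc 1 max ∧ r.sidx q = s ∧
        inv {x ∈ Finset.Icc 1 max | r.sidx x = s ∧ r.loc x < r.loc q} c) ∨
      (q = 0 ∧ inv {x ∈ Finset.Icc 1 max | r.sidx x = s} c))
    (fun q _ => if q = 0 then 0 else r.fin s - r.loc q) ?_ ?_ ?_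
  · rintro q c (⟨hq, hqs, hinv⟩ | ⟨rfl, -⟩) hc
    · refine (hstep _ q c hinv hq hqs (by simp)).mono ?_
      rintro q' c' ⟨rfl, hinv'⟩
      have hb := h.loc_bounds hq
      rw [hqs] at hb
      have hins : insert q {x ∈ Finset.Icc 1 max | r.sidx x = s ∧ r.loc x < r.loc q} =
          {x ∈ Finset.Icc 1 max | r.sidx x = s ∧ r.loc x < r.loc q + 1} := by
        ext x
        simp only [Finset.mem_insert, Finset.mem_filter]
        constructor
        · rintro (rfl | ⟨hx, hxs, hlt⟩)
          · exact ⟨hq, hqs, Nat.lt_succ_self _⟩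
          · exact ⟨hx, hxs, by omega⟩
        · rintro ⟨hx, hxs, hlt⟩
          by_cases heq : r.loc x = r.loc q
          · left
            rw [← h.elems_loc x hx, heq, h.elems_loc q hq]
          · exact .inr ⟨hx, hxs, by omega⟩
      rw [hins] at hinv'
      unfold next
      rw [hqs]
      rw [if_neg hc]
      by_cases hend : r.loc q + 1 ≥ r.fin s
      · rw [if_pos hend, if_pos rfl]
        refine ⟨.inr ⟨rfl, ?_⟩, by omega⟩
        have hall : ({x ∈ Finset.Icc 1 max | r.sidx x = s} : Finset ℕ) =
            {x ∈ Finset.Icc 1 max | r.sidx x = s ∧ r.loc x < r.loc q + 1} := by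
          refine Finset.filter_congr fun x hx => ⟨fun hxs => ⟨hxs, ?_⟩, And.left⟩
          have := h.loc_bounds hx
          rw [hxs] at this
          omega
        rw [hall]
        exact hinv'
      · rw [if_neg hend]
        obtain ⟨hi, his⟩ := h.sidx_elems hs (i := r.loc q + 1) (by omega) (by omega)
        have hne : r.elems (r.loc q + 1) ≠ 0 := by
          have := Finset.mem_Icc.1 (h.elems_mem _ hi)
          omega
        rw [if_neg hne, h.loc_elems _ hi]
        exact ⟨.inl ⟨h.elems_mem _ hi, his, hinv'⟩, by omega⟩
    · exact absurd rfl hc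
  · rintro q c (⟨hq, -, -⟩ | ⟨rfl, hinv⟩) hc
    · have := Finset.mem_Icc.1 hq
      omega
    · exact hpost _ _ hinv
  · obtain ⟨hi, his⟩ := h.sidx_elems hs le_rfl hr.2.1
    refine .inl ⟨h.elems_mem _ hi, his, ?_⟩
    convert h₀
    rw [Finset.filter_eq_empty_iff]
    rintro x hx ⟨hxs, hlt⟩
    have := h.loc_bounds hx
    rw [hxs] at this
    rw [h.loc_elems _ hi] at hlt
    omega

/-! ### The represented family -/

theorem Represents.sidx_eq_iff {r : RP max} {P : Finset (Finset ℕ)} (h : r.Represents P)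
    {x y : ℕ} (hx : x ∈ Finset.Icc 1 max) (hy : y ∈ Finset.Icc 1 max) :
    r.sidx x = r.sidx y ↔ ∃ B ∈ P, x ∈ B ∧ y ∈ B := by
  obtain ⟨hwf, -, rfl⟩ := h
  simp only [Finset.mem_image]
  constructor
  · intro heq
    have hs := hwf.sidx_mem x hx
    exact ⟨_, ⟨_, hs, rfl⟩, (hwf.mem_members hs).2 ⟨hx, rfl⟩, (hwf.mem_members hs).2 ⟨hy, heq.symm⟩⟩
  · rintro ⟨_, ⟨s, hs, rfl⟩, hxs, hys⟩
    rw [((hwf.mem_members hs).1 hxs).2, ((hwf.mem_members hs).1 hys).2]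

theorem represents_of_sidx_eq_iff {r : RP max} (h : r.WellFormed)
    (hunmarked : ∀ x ∈ Finset.Icc 1 max, ¬ r.Marked x) {P : Finset (Finset ℕ)}
    (hne : ∀ B ∈ P, B.Nonempty) (hsub : ∀ B ∈ P, B ⊆ Finset.Icc 1 max)
    (hdisj : ∀ B ∈ P, ∀ B' ∈ P, ∀ x ∈ B, x ∈ B' → B = B')
    (heq : ∀ x ∈ Finset.Icc 1 max, ∀ y ∈ Finset.Icc 1 max,
      r.sidx x = r.sidx y ↔ ∃ B ∈ P, x ∈ B ∧ y ∈ B) : r.Represents P := by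
  have key : ∀ B ∈ P, ∀ x ∈ B, r.members (r.sidx x) = B := by
    intro B hB x hxB
    have hx := hsub B hB hxB
    ext y
    rw [h.mem_members (h.sidx_mem x hx)]
    constructor
    · rintro ⟨hy, hyx⟩
      obtain ⟨B', hB', hyB', hxB'⟩ := (heq y hy x hx).1 hyx
      rwa [hdisj B hB B' hB' x hxB hxB']
    · intro hyB
      exact ⟨hsub B hB hyB, (heq y (hsub B hB hyB) x hx).2 ⟨B, hB, hyB, hxB⟩⟩
  refine ⟨h, fun s hs => (h.mid_eq_first_iff hs).2 fun x hx _ => hunmarked x hx, ?_⟩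
  ext B
  rw [Finset.mem_image]
  constructor
  · rintro ⟨s, hs, rfl⟩
    obtain ⟨x, hx, rfl⟩ := h.exists_mem hs
    obtain ⟨B, hB, hxB, -⟩ := (heq x hx x hx).1 rfl
    rwa [key B hB x hxB]
  · intro hB
    obtain ⟨x, hxB⟩ := hne B hB
    exact ⟨_, h.sidx_mem x (hsub B hB hxB), key B hB x hxB⟩

theorem Represents.not_marked {r : RP max} {P : Finset (Finset ℕ)} (h : r.Represents P)
    {x : ℕ} (hx : x ∈ Finset.Icc 1 max) : ¬ r.Marked x :=
  (h.1.mid_eq_first_iff (h.1.sidx_mem x hx)).1 (h.2.1 _ (h.1.sidx_mem x hx)) x hx rfl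

theorem IsInitial.wellFormed {r : RP max} (h : r.IsInitial) (hmax : 1 ≤ max) :
    r.WellFormed := by
  obtain ⟨h1, h2, h3, h4, h5⟩ := h
  have h6 : ∀ i ∈ Finset.Icc 1 max, r.elems i = i ∧ r.loc i = i ∧ r.sidx i = 1 :=
    fun i hi => h5 i (Finset.mem_Icc.1 hi).1 (Finset.mem_Icc.1 hi).2
  have h7 : ∀ s ∈ Finset.Icc 1 r.sets, s = 1 := by
    intro s hs
    rw [h1, Finset.mem_Icc] at hs
    omega
  constructor
  · intro i hi
    rwa [(h6 i hi).1]
  · intro i hi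
    rwa [(h6 i hi).2.1]
  · intro i hi
    rw [(h6 i hi).1, (h6 i hi).2.1]
  · intro i hi
    rw [(h6 i hi).2.1, (h6 i hi).1]
  · intro s hs
    rw [h7 s hs]
    omega
  · intro s hs
    rw [h7 s hs]
    omega
  · intro i hi
    rw [(h6 i hi).2.2, h1]
    simp
  · intro i hi s hs
    rw [h7 s hs, (h6 i hi).2.2, (h6 i hi).2.1]
    have := Finset.mem_Icc.1 hi
    omega

theorem IsInitial.sidx {r : RP max} (h : r.IsInitial) {x : ℕ} (hx : x ∈ Finset.Icc 1 max) :
    r.sidx x = 1 :=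
  (h.2.2.2.2 x (Finset.mem_Icc.1 hx).1 (Finset.mem_Icc.1 hx).2).2.2

theorem IsInitial.not_marked {r : RP max} (h : r.IsInitial) {x : ℕ}
    (hx : x ∈ Finset.Icc 1 max) : ¬ r.Marked x := by
  have hx' := Finset.mem_Icc.1 hx
  have := h.2.2.2.2 x hx'.1 hx'.2
  have := h.2.2.1
  unfold Marked
  grind

/-- Marks the elements of `S`, for a body that applies `Mark` to the part `r` of a
state `view r`. -/
theorem wp_markEach {σ : Type u} (view : RP max → σ) {body : ℕ → Comp σ Unit}
    (hbody : ∀ r q (post : σ → Prop), Wp (opMark q) r (fun _ r' => post (view r')) →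
      Wp (body q) (view r) fun _ s' => post s')
    {r : RP max} (h : r.WellFormed) {S : Finset ℕ} (hS : S ⊆ Finset.Icc 1 max) :
    Wp (forEach (fun _ => S) body) (view r) fun _ s' => ∃ r' : RP max, s' = view r' ∧
      r'.WellFormed ∧ r'.sets = r.sets ∧ r'.sidx = r.sidx ∧
      ∀ x ∈ Finset.Icc 1 max, r'.Marked x ↔ r.Marked x ∨ x ∈ S := by
  refine wp_forEach (fun l s' => (∀ q ∈ l, q ∈ S) ∧ ∃ r' : RP max, s' = view r' ∧
    r'.WellFormed ∧ r'.sets = r.sets ∧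
    r'.sidx = r.sidx ∧ ∀ x ∈ Finset.Icc 1 max, (r.Marked x → r'.Marked x) ∧
      (r'.Marked x → r.Marked x ∨ x ∈ S) ∧ (x ∈ S → x ∉ l → r'.Marked x)) ?_ ?_ ?_
  · rintro q l _ ⟨hl, r', rfl, hwf, hsets, hsidx, hmk⟩
    have hq := hl q List.mem_cons_self
    refine hbody _ _ _ ((wp_opMark hwf (hS hq)).mono ?_)
    rintro _ r'' ⟨hwf', hsets', hsidx', hmk'⟩
    refine ⟨fun x hx => hl x (List.mem_cons_of_mem _ hx), r'', rfl, hwf', hsets'.trans hsets,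
      hsidx'.trans hsidx, ?_⟩
    intro x hx
    have h1 := hmk x hx
    have h2 := hmk' x hx
    grind
  · rintro _ ⟨-, r', rfl, hwf, hsets, hsidx, hmk⟩
    refine ⟨r', rfl, hwf, hsets, hsidx, fun x hx => ?_⟩
    have h1 := hmk x hx
    grind
  · intro l _ hl
    refine ⟨fun q hq => (hl q).1 hq, r, rfl, h, rfl, rfl, fun x _ => ⟨id, .inl, ?_⟩⟩
    exact fun h1 h2 => absurd ((hl x).2 h1) h2

/-- Every partition of `{1, …, max}`, given by a colouring, is represented by some contents:
the colours can be split off one after the other. -/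
theorem exists_sidx_eq_iff {γ : Type*} (f : ℕ → γ) : ∃ r : RP max, r.WellFormed ∧
    (∀ x ∈ Finset.Icc 1 max, ¬ r.Marked x) ∧
    ∀ x ∈ Finset.Icc 1 max, ∀ y ∈ Finset.Icc 1 max, r.sidx x = r.sidx y ↔ f x = f y := by
  classical
  rcases Nat.eq_zero_or_pos max with rfl | hmax
  · refine ⟨⟨0, id, id, id, id, id, id⟩, ?_, ?_, ?_⟩
    · constructor <;> simp
    · simp
    · simp
  have key : ∀ L : Finset γ, ∃ r : RP max, r.WellFormed ∧
      (∀ x ∈ Finset.Icc 1 max, ¬ r.Marked x) ∧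
      ∀ x ∈ Finset.Icc 1 max, ∀ y ∈ Finset.Icc 1 max,
        r.sidx x = r.sidx y ↔ ∀ a ∈ L, f x = a ↔ f y = a := by
    intro L
    induction L using Finset.induction_on with
    | empty =>
      have hi : (⟨1, id, id, fun _ => 1, fun _ => 1, fun _ => max + 1, fun _ => 1⟩ :
          RP max).IsInitial := ⟨rfl, rfl, rfl, rfl, fun e _ _ => ⟨rfl, rfl, rfl⟩⟩
      exact ⟨_, hi.wellFormed hmax, fun x hx => hi.not_marked hx, fun x hx y hy => by simp⟩
    | insert a L ha ih =>
      obtain ⟨r, hwf, hun, hiff⟩ := ih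
      by_cases hex : ∃ x₀ ∈ Finset.Icc 1 max, f x₀ = a
      · obtain ⟨x₀, hx₀, hfx₀⟩ := hex
        have hw₁ := wp_markEach id (fun _ _ _ => id) hwf (S := {x ∈ Finset.Icc 1 max | f x = a})
          (Finset.filter_subset _ _)
        obtain ⟨_, _, hr₁⟩ := hw₁.2.1
        obtain ⟨r₁, -, hwf₁, hsets₁, hsidx₁, hmk₁⟩ := hw₁.2.2 _ _ hr₁
        have hw := wp_opSplit_isSplit hwf₁ (hwf₁.sidx_mem x₀ hx₀)
        obtain ⟨k, r₂, hr₂⟩ := hw.2.1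
        have hsp := hw.2.2 _ _ hr₂
        have hmk : ∀ x ∈ Finset.Icc 1 max, r₁.Marked x ↔ f x = a := by
          intro x hx
          rw [hmk₁ x hx, Finset.mem_filter]
          exact ⟨fun h => h.elim (fun h => absurd h (hun x hx)) And.right,
            fun h => .inr ⟨hx, h⟩⟩
        have hset : ∀ x ∈ Finset.Icc 1 max, f x = a → r₁.sidx x = r₁.sidx x₀ := by
          intro x hx hfx
          rw [hsidx₁, hiff x hx x₀ hx₀, hfx, hfx₀]
          exact fun _ _ => Iff.rfl
        refine ⟨r₂, hsp.wf, ?_, ?_⟩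
        · intro x hx hm
          obtain ⟨hm₁, hne⟩ := (hsp.marked x hx).1 hm
          exact hne (hset x hx ((hmk x hx).1 hm₁))
        · intro x hx y hy
          rw [hsp.same_set x hx y hy, hmk x hx, hmk y hy, Finset.forall_mem_insert, hsidx₁,
            hiff x hx y hy, and_comm]
          refine and_congr_left fun hxy => ⟨fun h => ?_, fun h _ => h⟩
          have hxy' := (hiff x hx y hy).2 hxy
          rw [hsidx₁] at hset
          constructor
          · exact fun hfx => (h (hset x hx hfx)).1 hfx
          · exact fun hfy => (h (hxy'.trans (hset y hy hfy))).2 hfy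
      · refine ⟨r, hwf, hun, fun x hx y hy => ?_⟩
        rw [hiff x hx y hy, Finset.forall_mem_insert]
        refine ⟨fun h => ⟨?_, h⟩, And.right⟩
        exact ⟨fun h' => absurd ⟨x, hx, h'⟩ hex, fun h' => absurd ⟨y, hy, h'⟩ hex⟩
  obtain ⟨r, hwf, hun, hiff⟩ := key ((Finset.Icc 1 max).image f)
  refine ⟨r, hwf, hun, fun x hx y hy => ?_⟩
  rw [hiff x hx y hy]
  refine ⟨fun h => ?_, fun h a _ => by rw [h]⟩
  exact ((h (f x) (Finset.mem_image_of_mem f hx)).1 rfl).symm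

/-! ### The collection of the sets that contain marks -/

/-- The simple set `T` consists of the indices of the sets that contain a marked element. -/
def Touched (r : RP max) (T : SimpleSet) : Prop :=
  T.Nodup ∧ ∀ p, p ∈ T ↔ ∃ x ∈ Finset.Icc 1 max, r.sidx x = p ∧ r.Marked x

theorem touched_zero_iff {r : RP max} :
    r.Touched 0 ↔ ∀ x ∈ Finset.Icc 1 max, ¬ r.Marked x := by
  constructor
  · rintro ⟨-, h⟩ x hx hm
    exact Multiset.notMem_zero _ ((h _).2 ⟨x, hx, rfl, hm⟩)
  · intro h
    refine ⟨Multiset.nodup_zero, fun p => ⟨fun hp => absurd hp (Multiset.notMem_zero _), ?_⟩⟩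
    rintro ⟨x, hx, -, hm⟩
    exact absurd hm (h x hx)

theorem Touched.mem_sets {r : RP max} {T : SimpleSet} (h : r.Touched T) (hwf : r.WellFormed)
    {p : ℕ} (hp : p ∈ T) : p ∈ Finset.Icc 1 r.sets := by
  obtain ⟨x, hx, rfl, -⟩ := (h.2 p).1 hp
  exact hwf.sidx_mem x hx

/-- A simple set of different indices of sets never overflows. -/
theorem card_lt_of_notMem {n p : ℕ} {T : Multiset ℕ} (hn : T.Nodup)
    (hT : ∀ q ∈ T, q ∈ Finset.Icc 1 n) (hp : p ∈ Finset.Icc 1 n) (hpT : p ∉ T) :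
    Multiset.card T < n := by
  have h1 : (⟨T, hn⟩ : Finset ℕ) ⊆ (Finset.Icc 1 n).erase p := by
    intro q hq
    have hq' : q ∈ T := hq
    exact Finset.mem_erase.2 ⟨fun h => hpT (h ▸ hq'), hT q hq'⟩
  have h2 := Finset.card_le_card h1
  rw [Finset.card_erase_of_mem hp, Finset.card_mk, Nat.card_Icc] at h2
  have := Finset.mem_Icc.1 hp
  omega

theorem Touched.card_lt {r : RP max} {T : SimpleSet} (h : r.Touched T) (hwf : r.WellFormed)
    {p : ℕ} (hp : p ∈ Finset.Icc 1 r.sets) (hpT : p ∉ T) : Multiset.card T < max :=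
  (card_lt_of_notMem h.1 (fun _ hq => h.mem_sets hwf hq) hp hpT).trans_le hwf.sets_le

theorem Touched.notMem_iff {r : RP max} {T : SimpleSet} (h : r.Touched T) (p : ℕ) :
    p ∉ T ↔ ∀ x ∈ Finset.Icc 1 max, r.sidx x = p → ¬ r.Marked x := by
  rw [h.2]
  push Not
  rfl

theorem Touched.mark {r r' : RP max} {T : SimpleSet} (h : r.Touched T) {e : ℕ}
    (he : e ∈ Finset.Icc 1 max) (hsidx : r'.sidx = r.sidx)
    (hmk : ∀ x ∈ Finset.Icc 1 max, r'.Marked x ↔ r.Marked x ∨ x = e) :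
    r'.Touched (if r.sidx e ∈ T then T else r.sidx e ::ₘ T) := by
  have hmem : ∀ p, (∃ x ∈ Finset.Icc 1 max, r'.sidx x = p ∧ r'.Marked x) ↔
      p ∈ T ∨ p = r.sidx e := by
    intro p
    rw [h.2, hsidx]
    constructor
    · rintro ⟨x, hx, rfl, hm⟩
      rcases (hmk x hx).1 hm with hm | rfl
      · exact .inl ⟨x, hx, rfl, hm⟩
      · exact .inr rfl
    · rintro (⟨x, hx, rfl, hm⟩ | rfl)
      · exact ⟨x, hx, rfl, (hmk x hx).2 (.inl hm)⟩
      · exact ⟨e, he, rfl, (hmk e he).2 (.inr rfl)⟩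
  split_ifs with hT
  · refine ⟨h.1, fun p => ?_⟩
    rw [hmem p]
    exact ⟨.inl, fun h => h.elim id fun h => h ▸ hT⟩
  · refine ⟨Multiset.nodup_cons.2 ⟨hT, h.1⟩, fun p => ?_⟩
    rw [hmem p, Multiset.mem_cons, or_comm]

/-- `Split(p)` removes the marks of `p` only, and the other sets keep their indices. -/
theorem Touched.split {r r' : RP max} {T : SimpleSet} (h : r.Touched T) {p k : ℕ}
    (hsp : r.IsSplit r' p k) : r'.Touched (T.erase p) := by
  refine ⟨h.1.erase p, fun p' => ?_⟩
  rw [h.1.mem_erase_iff, h.2]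
  constructor
  · rintro ⟨hne, x, hx, rfl, hm⟩
    exact ⟨x, hx, hsp.of_ne x hx hne, (hsp.marked x hx).2 ⟨hm, hne⟩⟩
  · rintro ⟨x, hx, rfl, hm⟩
    obtain ⟨hm', hne⟩ := (hsp.marked x hx).1 hm
    rw [hsp.of_ne x hx hne]
    exact ⟨hne, x, hx, rfl, hm'⟩

end RP

/-! ### The coarsest stable equivalence and the invariant of partition refinement -/

namespace PTDFA

variable {Q : Type u} {A : Type v}

/-- `R` is an equivalence of states that respects finality and the transitions; a state with a
transition labelled `a` is never related to one without. -/
structure Stable (D : PTDFA Q A) (R : Q → Q → Prop) : Prop where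
  equiv : Equivalence R
  final : ∀ x y, R x y → (x ∈ D.final ↔ y ∈ D.final)
  step : ∀ q a r q₂, (q, a, r) ∈ D.δ → R q q₂ → ∃ r₂, (q₂, a, r₂) ∈ D.δ ∧ R r r₂

/-- The coarsest stable equivalence. -/
def Indist (D : PTDFA Q A) (x y : Q) : Prop :=
  ∃ R, D.Stable R ∧ R x y

theorem Indist.symm {D : PTDFA Q A} {x y : Q} (h : D.Indist x y) : D.Indist y x :=
  let ⟨R, hR, hxy⟩ := h
  ⟨R, hR, hR.equiv.symm hxy⟩

theorem Indist.final_iff {D : PTDFA Q A} {x y : Q} (h : D.Indist x y) :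
    x ∈ D.final ↔ y ∈ D.final :=
  let ⟨_, hR, hxy⟩ := h
  hR.final x y hxy

theorem Indist.step {D : PTDFA Q A} {q q₂ r : Q} {a : A} (h : D.Indist q q₂)
    (hδ : (q, a, r) ∈ D.δ) : ∃ r₂, (q₂, a, r₂) ∈ D.δ ∧ D.Indist r r₂ :=
  let ⟨R, hR, hq⟩ := h
  let ⟨r₂, hr₂, hr⟩ := hR.step q a r q₂ hδ hq
  ⟨r₂, hr₂, R, hR, hr⟩

/-- Splitting by a splitter whose target `B` is a union of classes separates no
indistinguishable states. -/
theorem Indist.hits_iff {D : PTDFA Q A} {B : Q → Prop} (hB : ∀ r r₂, D.Indist r r₂ → B r → B r₂)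
    (a : A) {x y : Q} (h : D.Indist x y) :
    (∃ r, B r ∧ (x, a, r) ∈ D.δ) ↔ ∃ r, B r ∧ (y, a, r) ∈ D.δ := by
  have key : ∀ x y, D.Indist x y → (∃ r, B r ∧ (x, a, r) ∈ D.δ) →
      ∃ r, B r ∧ (y, a, r) ∈ D.δ := by
    rintro x y h ⟨r, hr, hδ⟩
    obtain ⟨r₂, hδ₂, hrr⟩ := h.step hδ
    exact ⟨r₂, hB r r₂ hrr hr, hδ₂⟩
  exact ⟨key x y h, key y x h.symm⟩

/-- The invariant that makes it safe to keep only one half of a processed splitter. `R` is the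
current equivalence, `U a r` says that the transitions labelled `a` into the block of `r` are an
unprocessed splitter. If `q` and `q₂` are related and `q` has a transition labelled `a`, then `q₂`
has a matching one, unless an unprocessed splitter tells `q` and `q₂` apart, or they are told
apart by the splitter that is being processed, which is described by the set `K` of the states
that have a transition in it, and the block of `q₂` is among those, collected in `E`, that have
not yet been split by it. -/
def Covered (D : PTDFA Q A) (R : Q → Q → Prop) (U : A → Q → Prop) (K E : Q → Prop) : Prop :=
  ∀ q a r, (q, a, r) ∈ D.δ → ∀ q₂, R q q₂ →
    U a r ∨ (∃ r₂, (q₂, a, r₂) ∈ D.δ ∧ (R r r₂ ∨ U a r₂)) ∨ (E q₂ ∧ ¬ (K q ↔ K q₂))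

variable {D : PTDFA Q A} {R R' : Q → Q → Prop} {U U' : A → Q → Prop} {K K' E E' : Q → Prop}

theorem Covered.of_all (h : ∀ q a r, (q, a, r) ∈ D.δ → U a r) : D.Covered R U K E :=
  fun q a r hδ _ _ => .inl (h q a r hδ)

/-- When a block is split, it suffices that one of its halves is added to the unprocessed
splitters. -/
theorem Covered.split (h : D.Covered R U K E) (hR : ∀ x y, R' x y → R x y)
    (hE : ∀ x y, R' x y → E y → (K x ↔ K y) ∨ E' y)
    (hU : ∀ q a r, (q, a, r) ∈ D.δ → U a r → U' a r)
    (hS : ∀ q a r q₂ r₂, (q, a, r) ∈ D.δ → (q₂, a, r₂) ∈ D.δ → R r r₂ → ¬ R' r r₂ →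
      U' a r ∨ U' a r₂) : D.Covered R' U' K E' := by
  intro q a r hδ q₂ hq
  rcases h q a r hδ q₂ (hR _ _ hq) with hr | ⟨r₂, hδ₂, hr | hr⟩ | ⟨hq₂, hK⟩
  · exact .inl (hU q a r hδ hr)
  · by_cases hr' : R' r r₂
    · exact .inr (.inl ⟨r₂, hδ₂, .inl hr'⟩)
    · rcases hS q a r q₂ r₂ hδ hδ₂ hr hr' with h' | h'
      · exact .inl h'
      · exact .inr (.inl ⟨r₂, hδ₂, .inr h'⟩)
  · exact .inr (.inl ⟨r₂, hδ₂, .inr (hU _ _ _ hδ₂ hr)⟩)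
  · exact .inr (.inr ⟨(hE _ _ hq hq₂).resolve_left hK, hK⟩)

/-- Taking the splitter of the transitions labelled `a₀` into `B` from the unprocessed ones. -/
theorem Covered.remove (h : D.Covered R U K' fun _ => False) (a₀ : A) (B : Q → Prop)
    (hB : ∀ r r₂, B r → B r₂ → R r r₂)
    (hU : ∀ q a r, (q, a, r) ∈ D.δ → U a r → U' a r ∨ (a = a₀ ∧ B r))
    (hK : ∀ q, K q ↔ ∃ r, B r ∧ (q, a₀, r) ∈ D.δ)
    (hE : ∀ x y, R x y → K x ∨ K y → E y) : D.Covered R U' K E := by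
  intro q a r hδ q₂ hq
  rcases h q a r hδ q₂ hq with hr | ⟨r₂, hδ₂, hr | hr⟩ | ⟨h', -⟩
  · rcases hU q a r hδ hr with hr' | ⟨rfl, hr'⟩
    · exact .inl hr'
    · have hKq : K q := (hK q).2 ⟨r, hr', hδ⟩
      by_cases hKq₂ : K q₂
      · obtain ⟨r₂, hr₂, hδ₂⟩ := (hK q₂).1 hKq₂
        exact .inr (.inl ⟨r₂, hδ₂, .inl (hB r r₂ hr' hr₂)⟩)
      · exact .inr (.inr ⟨hE q q₂ hq (.inl hKq), fun hh => hKq₂ (hh.1 hKq)⟩)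
  · exact .inr (.inl ⟨r₂, hδ₂, .inl hr⟩)
  · rcases hU q₂ a r₂ hδ₂ hr with hr' | ⟨rfl, hr'⟩
    · exact .inr (.inl ⟨r₂, hδ₂, .inr hr'⟩)
    · have hKq₂ : K q₂ := (hK q₂).2 ⟨r₂, hr', hδ₂⟩
      by_cases hKq : K q
      · obtain ⟨r', hr₂, hδ'⟩ := (hK q).1 hKq
        obtain rfl := D.det q a r r' hδ hδ'
        exact .inr (.inl ⟨r₂, hδ₂, .inl (hB r r₂ hr₂ hr')⟩)
      · exact .inr (.inr ⟨hE q q₂ hq (.inr hKq₂), fun hh => hKq (hh.2 hKq₂)⟩)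
  · exact h'.elim

theorem Covered.not_unprocessed (h : D.Covered R U K E) (hE : ∀ q, ¬ E q) :
    D.Covered R U K' fun _ => False := by
  intro q a r hδ q₂ hq
  rcases h q a r hδ q₂ hq with hr | hr | hr
  · exact .inl hr
  · exact .inr (.inl hr)
  · exact (hE _ hr.1).elim

/-- Without unprocessed splitters the current equivalence is the coarsest stable one. -/
theorem Covered.iff_indist (h : D.Covered R U K fun _ => False) (hU : ∀ a r, ¬ U a r)
    (hR : Equivalence R) (hfinal : ∀ x y, R x y → (x ∈ D.final ↔ y ∈ D.final))
    (hcoarse : ∀ x y, D.Indist x y → R x y) (x y : Q) : R x y ↔ D.Indist x y := by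
  refine ⟨fun hxy => ⟨R, ⟨hR, hfinal, ?_⟩, hxy⟩, hcoarse x y⟩
  intro q a r q₂ hδ hq
  rcases h q a r hδ q₂ hq with hr | ⟨r₂, hδ₂, hr | hr⟩ | ⟨h', -⟩
  · exact (hU _ _ hr).elim
  · exact ⟨r₂, hδ₂, hr⟩
  · exact (hU _ _ hr).elim
  · exact h'.elim

open Classical in
/-- The classes of the coarsest stable equivalence. -/
noncomputable def classes [Fintype Q] (D : PTDFA Q A) : Finset (Finset Q) :=
  Finset.univ.image fun x => Finset.univ.filter fun y => D.Indist x y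

theorem mem_classes [Fintype Q] {D : PTDFA Q A} {B : Finset Q} :
    B ∈ D.classes ↔ ∃ x, ∀ y, y ∈ B ↔ D.Indist x y := by
  unfold classes
  simp only [Finset.mem_image, Finset.mem_univ, true_and, Finset.ext_iff, Finset.mem_filter]
  exact exists_congr fun x => forall_congr' fun y => Iff.comm

end PTDFA

/-! ### The abstract algorithm -/

section AbstractCorrectness

open Comp

variable {Q : Type u} {A : Type v}

/-- `x` and `y` are in the same block. -/
def SameBlock (blocks : Finset (Finset Q)) (x y : Q) : Prop :=
  ∃ B ∈ blocks, x ∈ B ∧ y ∈ B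

/-- The pair of the block of `r` and the letter `a` is an unprocessed splitter. -/
def Unproc (unproc : Finset (Finset Q × A)) (a : A) (r : Q) : Prop :=
  ∃ B, (B, a) ∈ unproc ∧ r ∈ B

/-- The blocks form a partition that is refined by indistinguishability and refines
`{F, Q \ F}`, and the unprocessed splitters are given by blocks. -/
structure AbsInv (D : PTDFA Q A) (s : AbsState Q A) : Prop where
  nonempty : ∀ B ∈ s.blocks, B.Nonempty
  disjoint : ∀ B ∈ s.blocks, ∀ B' ∈ s.blocks, ∀ x ∈ B, x ∈ B' → B = B'
  cover : ∀ x, ∃ B ∈ s.blocks, x ∈ B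
  unproc_mem : ∀ x ∈ s.unproc, x.1 ∈ s.blocks
  coarse : ∀ x y, D.Indist x y → SameBlock s.blocks x y
  final : ∀ x y, SameBlock s.blocks x y → (x ∈ D.final ↔ y ∈ D.final)

theorem AbsInv.equivalence {D : PTDFA Q A} {s : AbsState Q A} (h : AbsInv D s) :
    Equivalence (SameBlock s.blocks) where
  refl x := let ⟨B, hB, hx⟩ := h.cover x; ⟨B, hB, hx, hx⟩
  symm := fun ⟨B, hB, hx, hy⟩ => ⟨B, hB, hy, hx⟩
  trans := by
    rintro x y z ⟨B, hB, hx, hy⟩ ⟨B', hB', hy', hz⟩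
    obtain rfl := h.disjoint B hB B' hB' y hy hy'
    exact ⟨B, hB, hx, hz⟩

theorem AbsInv.mem_of_sameBlock {D : PTDFA Q A} {s : AbsState Q A} (h : AbsInv D s)
    {B : Finset Q} (hB : B ∈ s.blocks) {x y : Q} (hxy : SameBlock s.blocks x y) (hx : x ∈ B) :
    y ∈ B := by
  obtain ⟨B', hB', hx', hy⟩ := hxy
  rwa [h.disjoint B hB B' hB' x hx hx']

theorem AbsInv.blocks_eq_classes [Fintype Q] {D : PTDFA Q A} {s : AbsState Q A}
    (h : AbsInv D s) (hiff : ∀ x y, SameBlock s.blocks x y ↔ D.Indist x y) :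
    s.blocks = D.classes := by
  have key : ∀ B ∈ s.blocks, ∀ x ∈ B, ∀ y, y ∈ B ↔ D.Indist x y := by
    intro B hB x hx y
    rw [← hiff]
    exact ⟨fun hy => ⟨B, hB, hx, hy⟩, fun hy => h.mem_of_sameBlock hB hy hx⟩
  ext B
  rw [PTDFA.mem_classes]
  constructor
  · intro hB
    obtain ⟨x, hx⟩ := h.nonempty B hB
    exact ⟨x, key B hB x hx⟩
  · rintro ⟨x, hx⟩
    obtain ⟨B', hB', hxB'⟩ := h.cover x
    have : B = B' := by
      ext y
      rw [hx, key B' hB' x hxB']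
    rwa [this]

variable [DecidableEq Q] [DecidableEq A]

theorem into_ne_empty {D : PTDFA Q A} {X : Finset Q} {q r : Q} {b : A} (hδ : (q, b, r) ∈ D.δ)
    (hr : r ∈ X) : D.into X b ≠ ∅ :=
  Finset.nonempty_iff_ne_empty.1 ⟨_, Finset.mem_filter.2 ⟨hδ, hr, rfl⟩⟩

/-- The effect of replacing the block `C` by its nonempty parts `C₁`, in which `K` holds, and
`C₂`, in which it does not; `X` and `Y` stand for the small and the big part. -/
theorem AbsInv.replace {D : PTDFA Q A} {s s' : AbsState Q A} (h : AbsInv D s) {K : Q → Prop}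
    (hK : ∀ x y, D.Indist x y → (K x ↔ K y)) {C C₁ C₂ X Y : Finset Q} (hC : C ∈ s.blocks)
    (hC₁ : ∀ x, x ∈ C₁ ↔ x ∈ C ∧ K x) (hC₂ : ∀ x, x ∈ C₂ ↔ x ∈ C ∧ ¬ K x)
    (hne₁ : C₁.Nonempty) (hne₂ : C₂.Nonempty) (hXY : X = C₁ ∧ Y = C₂ ∨ X = C₂ ∧ Y = C₁)
    (hblocks : s'.blocks = s.blocks \ {C} ∪ {C₁, C₂})
    (hunproc : ∀ B b, (B, b) ∈ s'.unproc ↔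
      (((B, b) ∈ s.unproc ∨ B = X ∧ D.into X b ≠ ∅) ∨
        B = Y ∧ D.into Y b ≠ ∅ ∧ ((C, b) ∈ s.unproc ∨ C = X ∧ D.into X b ≠ ∅)) ∧ B ≠ C) :
    AbsInv D s' ∧ (∀ C' ∈ s.blocks, C' ≠ C → C' ∈ s'.blocks) ∧
      (∀ x y, SameBlock s'.blocks x y ↔ SameBlock s.blocks x y ∧ (y ∈ C → (K x ↔ K y))) ∧
      (∀ q b r, (q, b, r) ∈ D.δ → Unproc s.unproc b r → Unproc s'.unproc b r) ∧
      (∀ q b r q₂ r₂, (q, b, r) ∈ D.δ → (q₂, b, r₂) ∈ D.δ → SameBlock s.blocks r r₂ →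
        ¬ SameBlock s'.blocks r r₂ → Unproc s'.unproc b r ∨ Unproc s'.unproc b r₂) ∧
      s.blocks.card < s'.blocks.card := by
  have hmem : ∀ B, B ∈ s'.blocks ↔ (B ∈ s.blocks ∧ B ≠ C) ∨ B = C₁ ∨ B = C₂ := by
    intro B
    rw [hblocks, Finset.mem_union, Finset.mem_sdiff, Finset.mem_singleton, Finset.mem_insert,
      Finset.mem_singleton]
  obtain ⟨x₁, hx₁⟩ := hne₁
  obtain ⟨x₂, hx₂⟩ := hne₂
  have h₁ := (hC₁ x₁).1 hx₁
  have h₂ := (hC₂ x₂).1 hx₂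
  have hne1 : C₁ ≠ C := fun he => by
    rw [← he, hC₁] at h₂
    exact h₂.2 h₂.1.2
  have hne2 : C₂ ≠ C := fun he => by
    rw [← he, hC₂] at h₁
    exact h₁.1.2 h₁.2
  have hne12 : C₁ ≠ C₂ := fun he => by
    rw [he, hC₂] at hx₁
    exact hx₁.2 h₁.2
  have hout : ∀ B ∈ s.blocks, B ≠ C → ∀ x ∈ B, x ∉ C :=
    fun B hB hne x hx hxC => hne (h.disjoint B hB C hC x hx hxC)
  have hsame : ∀ x y, SameBlock s'.blocks x y ↔
      SameBlock s.blocks x y ∧ (y ∈ C → (K x ↔ K y)) := by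
    intro x y
    constructor
    · rintro ⟨B, hB, hx, hy⟩
      rcases (hmem B).1 hB with ⟨hB, hne⟩ | rfl | rfl
      · exact ⟨⟨B, hB, hx, hy⟩, fun hyC => absurd hyC (hout B hB hne y hy)⟩
      · rw [hC₁] at hx hy
        exact ⟨⟨C, hC, hx.1, hy.1⟩, fun _ => iff_of_true hx.2 hy.2⟩
      · rw [hC₂] at hx hy
        exact ⟨⟨C, hC, hx.1, hy.1⟩, fun _ => iff_of_false hx.2 hy.2⟩
    · rintro ⟨⟨B, hB, hx, hy⟩, hxy⟩
      by_cases hBC : B = C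
      · subst hBC
        by_cases hKy : K y
        · exact ⟨C₁, (hmem _).2 (.inr (.inl rfl)), (hC₁ x).2 ⟨hx, (hxy hy).2 hKy⟩,
            (hC₁ y).2 ⟨hy, hKy⟩⟩
        · exact ⟨C₂, (hmem _).2 (.inr (.inr rfl)), (hC₂ x).2 ⟨hx, fun hh => hKy ((hxy hy).1 hh)⟩,
            (hC₂ y).2 ⟨hy, hKy⟩⟩
      · exact ⟨B, (hmem B).2 (.inl ⟨hB, hBC⟩), hx, hy⟩
  have hX : X ≠ C := by
    rcases hXY with ⟨rfl, -⟩ | ⟨rfl, -⟩ <;> assumption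
  have hY : Y ≠ C := by
    rcases hXY with ⟨-, rfl⟩ | ⟨-, rfl⟩ <;> assumption
  have hXm : ∀ q b r, (q, b, r) ∈ D.δ → r ∈ X → Unproc s'.unproc b r := fun q b r hδ hr =>
    ⟨X, (hunproc X b).2 ⟨.inl (.inr ⟨rfl, into_ne_empty hδ hr⟩), hX⟩, hr⟩
  refine ⟨⟨?_, ?_, ?_, ?_, ?_, ?_⟩, ?_, hsame, ?_, ?_, ?_⟩
  · intro B hB
    rcases (hmem B).1 hB with ⟨hB, -⟩ | rfl | rfl
    · exact h.nonempty B hB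
    · exact ⟨_, hx₁⟩
    · exact ⟨_, hx₂⟩
  · intro B hB B' hB' x hx hx'
    rw [hmem] at hB hB'
    have h3 := hC₁ x
    have h4 := hC₂ x
    rcases hB with ⟨hB, hne⟩ | rfl | rfl <;> rcases hB' with ⟨hB', hne'⟩ | rfl | rfl
    · exact h.disjoint B hB B' hB' x hx hx'
    · exact absurd (h3.1 hx').1 (hout B hB hne x hx)
    · exact absurd (h4.1 hx').1 (hout B hB hne x hx)
    · exact absurd (h3.1 hx).1 (hout B' hB' hne' x hx')
    · rfl
    · exact absurd (h3.1 hx).2 (h4.1 hx').2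
    · exact absurd (h4.1 hx).1 (hout B' hB' hne' x hx')
    · exact absurd (h3.1 hx').2 (h4.1 hx).2
    · rfl
  · intro x
    obtain ⟨B, hB, hx, -⟩ := (hsame x x).2 ⟨h.equivalence.refl x, fun _ => Iff.rfl⟩
    exact ⟨B, hB, hx⟩
  · rintro ⟨B, b⟩ hB
    rw [hunproc] at hB
    rw [hmem]
    obtain ⟨(hB | ⟨rfl, -⟩) | ⟨rfl, -⟩, hne⟩ := hB
    · exact .inl ⟨h.unproc_mem _ hB, hne⟩
    · exact .inr (hXY.imp And.left And.left)
    · exact .inr (hXY.symm.imp And.right And.right)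
  · exact fun x y hxy => (hsame x y).2 ⟨h.coarse x y hxy, fun _ => hK x y hxy⟩
  · exact fun x y hxy => h.final x y ((hsame x y).1 hxy).1
  · exact fun C' hC' hne => (hmem C').2 (.inl ⟨hC', hne⟩)
  · rintro q b r hδ ⟨B, hB, hr⟩
    by_cases hBC : B = C
    · subst hBC
      have hXYr : r ∈ X ∨ r ∈ Y := by
        by_cases hKr : K r
        · have hr₁ := (hC₁ r).2 ⟨hr, hKr⟩
          rcases hXY with ⟨rfl, rfl⟩ | ⟨rfl, rfl⟩
          exacts [.inl hr₁, .inr hr₁]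
        · have hr₂ := (hC₂ r).2 ⟨hr, hKr⟩
          rcases hXY with ⟨rfl, rfl⟩ | ⟨rfl, rfl⟩
          exacts [.inr hr₂, .inl hr₂]
      rcases hXYr with hr' | hr'
      · exact hXm q b r hδ hr'
      · exact ⟨Y, (hunproc Y b).2 ⟨.inr ⟨rfl, into_ne_empty hδ hr', .inl hB⟩, hY⟩, hr'⟩
    · exact ⟨B, (hunproc B b).2 ⟨.inl (.inl hB), hBC⟩, hr⟩
  · intro q b r q₂ r₂ hδ hδ₂ hrr hrr'
    rw [hsame] at hrr'
    push Not at hrr'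
    obtain ⟨hr₂, hKr⟩ := hrr' hrr
    have hr := h.mem_of_sameBlock hC (h.equivalence.symm hrr) hr₂
    -- The states `r` and `r₂` lie in different halves of `C`, so one of them is in the small half.
    have hor : r ∈ X ∨ r₂ ∈ X := by
      rcases hXY with ⟨rfl, -⟩ | ⟨rfl, -⟩
      · rw [hC₁, hC₁]
        tauto
      · rw [hC₂, hC₂]
        tauto
    exact hor.imp (hXm q b r hδ) (hXm q₂ b r₂ hδ₂)
  · have hd : Disjoint (s.blocks \ {C}) {C₁, C₂} := by
      rw [Finset.disjoint_right]
      intro B hB hB'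
      rw [Finset.mem_sdiff, Finset.mem_singleton] at hB'
      rw [Finset.mem_insert, Finset.mem_singleton] at hB
      rcases hB with rfl | rfl
      · exact hout _ hB'.1 hB'.2 _ hx₁ h₁.1
      · exact hout _ hB'.1 hB'.2 _ hx₂ h₂.1
    rw [hblocks, Finset.card_union_of_disjoint hd, Finset.card_pair hne12,
      Finset.card_sdiff_of_subset (Finset.singleton_subset_iff.2 hC), Finset.card_singleton]
    omega

variable [Fintype A]

theorem wp_abstractSplit {D : PTDFA Q A} {s : AbsState Q A} (h : AbsInv D s) {B : Finset Q}
    {a : A} (hK : ∀ x y, D.Indist x y → (D.Hits B a x ↔ D.Hits B a y)) {C : Finset Q}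
    (hC : C ∈ s.blocks) (hCK : ∃ q ∈ C, D.Hits B a q) :
    Wp (abstractSplit D B a C) s fun _ s' => AbsInv D s' ∧
      (∀ C' ∈ s.blocks, C' ≠ C → C' ∈ s'.blocks) ∧
      (∀ x y, SameBlock s'.blocks x y ↔
        SameBlock s.blocks x y ∧ (y ∈ C → (D.Hits B a x ↔ D.Hits B a y))) ∧
      (∀ q b r, (q, b, r) ∈ D.δ → Unproc s.unproc b r → Unproc s'.unproc b r) ∧
      (∀ q b r q₂ r₂, (q, b, r) ∈ D.δ → (q₂, b, r₂) ∈ D.δ → SameBlock s.blocks r r₂ →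
        ¬ SameBlock s'.blocks r r₂ → Unproc s'.unproc b r ∨ Unproc s'.unproc b r₂) ∧
      (s' = s ∨ s.blocks.card < s'.blocks.card) := by
  classical
  have hC₁ : ∀ x, x ∈ C.filter (fun q => D.Hits B a q) ↔ x ∈ C ∧ D.Hits B a x :=
    fun x => Finset.mem_filter
  have hC₂ : ∀ x, x ∈ C \ C.filter (fun q => D.Hits B a q) ↔ x ∈ C ∧ ¬ D.Hits B a x := by
    intro x
    rw [Finset.mem_sdiff, hC₁]
    tauto
  unfold abstractSplit
  dsimp only
  by_cases hne : C \ C.filter (fun q => D.Hits B a q) = ∅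
  · rw [if_neg (not_not_intro hne)]
    refine wp_pure.2 ⟨h, fun _ hC' _ => hC', fun x y => ?_, fun _ _ _ _ => id,
      fun _ _ _ _ _ _ _ hs hs' => absurd hs hs', .inl rfl⟩
    refine ⟨fun hxy => ⟨hxy, fun hy => ?_⟩, And.left⟩
    have hall : ∀ x ∈ C, D.Hits B a x := by
      intro x hx
      by_contra hh
      exact Finset.notMem_empty x (hne ▸ (hC₂ x).2 ⟨hx, hh⟩)
    exact iff_of_true (hall x (h.mem_of_sameBlock hC (h.equivalence.symm hxy) hy)) (hall y hy)
  · rw [if_pos hne]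
    simp only [wp_update_bind]
    refine wp_update.2 ?_
    dsimp only
    obtain ⟨q₀, hq₀, hh₀⟩ := hCK
    have hrep := fun X Y hXY s' hb hu => h.replace (s' := s') hK hC hC₁ hC₂
      ⟨q₀, (hC₁ q₀).2 ⟨hq₀, hh₀⟩⟩ (Finset.nonempty_iff_ne_empty.2 hne) (X := X) (Y := Y) hXY hb hu
    refine And.imp_right (And.imp_right (And.imp_right (And.imp_right
      (And.imp_right Or.inr)))) ?_
    split_ifs with hcard
    · refine hrep _ _ (.inl ⟨rfl, rfl⟩) _ rfl fun B b => ?_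
      simp only [Finset.mem_sdiff, Finset.mem_union, Finset.mem_product, Finset.mem_singleton,
        Finset.mem_filter, Finset.mem_univ, true_and, and_true, ne_eq]
    · refine hrep _ _ (.inr ⟨rfl, rfl⟩) _ rfl fun B b => ?_
      simp only [Finset.mem_sdiff, Finset.mem_union, Finset.mem_product, Finset.mem_singleton,
        Finset.mem_filter, Finset.mem_univ, true_and, and_true, ne_eq]

variable [Fintype Q]

theorem wp_abstractMain (D : PTDFA Q A) (hF : D.final.Nonempty) (s₀ : AbsState Q A) :
    Wp (abstractMain D) s₀ fun _ s => s.blocks = D.classes := by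
  classical
  unfold abstractMain
  simp only [wp_update_bind]
  generalize hs' : AbsState.mk _ _ = s
  have hs := hs'.symm
  clear hs'
  have hmem : ∀ B, B ∈ s.blocks ↔ B = D.final ∨ (B = Finset.univ \ D.final ∧ B.Nonempty) := by
    intro B
    rw [hs]
    dsimp only
    split_ifs with hu
    · rw [Finset.mem_singleton, ← hu, Finset.sdiff_self]
      refine ⟨.inl, fun h => h.elim id ?_⟩
      rintro ⟨rfl, hn⟩
      exact absurd hn Finset.not_nonempty_empty
    · rw [Finset.mem_insert, Finset.mem_singleton]
      refine or_congr_right ⟨fun h => ⟨h, ?_⟩, And.left⟩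
      rw [h, Finset.sdiff_nonempty]
      exact fun hsub => hu (Finset.Subset.antisymm hsub (Finset.subset_univ _))
  have hsame : ∀ x y, SameBlock s.blocks x y ↔ (x ∈ D.final ↔ y ∈ D.final) := by
    intro x y
    constructor
    · rintro ⟨B, hB, hx, hy⟩
      rcases (hmem B).1 hB with rfl | ⟨rfl, -⟩
      · exact iff_of_true hx hy
      · exact iff_of_false (Finset.mem_sdiff.1 hx).2 (Finset.mem_sdiff.1 hy).2
    · intro hxy
      by_cases hx : x ∈ D.final
      · exact ⟨_, (hmem _).2 (.inl rfl), hx, hxy.1 hx⟩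
      · have hx' : x ∈ Finset.univ \ D.final := Finset.mem_sdiff.2 ⟨Finset.mem_univ _, hx⟩
        exact ⟨_, (hmem _).2 (.inr ⟨rfl, x, hx'⟩), hx',
          Finset.mem_sdiff.2 ⟨Finset.mem_univ _, fun hy => hx (hxy.2 hy)⟩⟩
  have hunproc : ∀ x, x ∈ s.unproc ↔ x.1 ∈ s.blocks ∧ D.into x.1 x.2 ≠ ∅ := by
    intro x
    rw [hs]
    simp
  have hinv : AbsInv D s := by
    refine ⟨?_, ?_, ?_, ?_, ?_, ?_⟩
    · intro B hB
      rcases (hmem B).1 hB with rfl | h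
      exacts [hF, h.2]
    · intro B hB B' hB' x hx hx'
      rcases (hmem B).1 hB with rfl | ⟨rfl, -⟩ <;> rcases (hmem B').1 hB' with rfl | ⟨rfl, -⟩
      · rfl
      · exact absurd hx (Finset.mem_sdiff.1 hx').2
      · exact absurd hx' (Finset.mem_sdiff.1 hx).2
      · rfl
    · intro x
      obtain ⟨B, hB, hx, -⟩ := (hsame x x).2 Iff.rfl
      exact ⟨B, hB, hx⟩
    · exact fun x hx => ((hunproc x).1 hx).1
    · exact fun x y hxy => (hsame x y).2 hxy.final_iff
    · exact fun x y => (hsame x y).1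
  have hcov : D.Covered (SameBlock s.blocks) (Unproc s.unproc) (fun _ => False)
      fun _ => False := by
    refine .of_all fun q a r hδ => ?_
    obtain ⟨B, hB, hr⟩ := hinv.cover r
    exact ⟨B, (hunproc _).2 ⟨hB, into_ne_empty hδ hr⟩, hr⟩
  clear hs hmem hsame hunproc
  -- A round either adds a block or only removes a splitter, whence the lexicographic variant.
  refine wp_whileDo (γ := ℕ ×ₗ ℕ) (fun s => AbsInv D s ∧
      D.Covered (SameBlock s.blocks) (Unproc s.unproc) (fun _ => False) fun _ => False)
    (fun s => toLex (Fintype.card (Finset Q) - s.blocks.card, s.unproc.card)) ?_ ?_ ⟨hinv, hcov⟩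
  · clear hinv hcov
    rintro s ⟨hinv, hcov⟩ hne
    obtain ⟨x₀, hx₀⟩ := Finset.nonempty_iff_ne_empty.2 hne
    refine wp_bind (wp_choose ⟨x₀, s, hx₀, rfl⟩ ?_)
    rintro ⟨B, a⟩ s' ⟨hx, hs'⟩
    rw [hs', wp_update_bind]
    clear hs' s'
    have hB := hinv.unproc_mem _ hx
    obtain ⟨s₁, hs₁⟩ : ∃ s₁ : AbsState Q A, s₁ = ⟨s.blocks, s.unproc \ {(B, a)}⟩ := ⟨_, rfl⟩
    have hb₁ : s₁.blocks = s.blocks := by rw [hs₁]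
    have hu₁ : s₁.unproc = s.unproc \ {(B, a)} := by rw [hs₁]
    have hlt : s₁.unproc.card < s.unproc.card := by
      rw [hu₁]
      exact Finset.card_lt_card (Finset.sdiff_ssubset (Finset.singleton_subset_iff.2 hx)
        (Finset.singleton_nonempty _))
    have hinv₁ : AbsInv D s₁ := by
      obtain ⟨h1, h2, h3, h4, h5, h6⟩ := hinv
      rw [← hb₁] at h1 h2 h3 h4 h5 h6
      exact ⟨h1, h2, h3, fun x hx => h4 x (by rw [hu₁] at hx; exact (Finset.mem_sdiff.1 hx).1),
        h5, h6⟩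
    have hK : ∀ x y, D.Indist x y → (D.Hits B a x ↔ D.Hits B a y) := fun x y hxy =>
      hxy.hits_iff (B := (· ∈ B)) (fun r r₂ hrr hr =>
        hinv.mem_of_sameBlock hB (hinv.coarse r r₂ hrr) hr) a
    refine (wp_forEach (fun l s' => AbsInv D s' ∧ l.Nodup ∧
      (∀ C ∈ l, C ∈ s'.blocks ∧ ∃ q ∈ C, D.Hits B a q) ∧
      D.Covered (SameBlock s'.blocks) (Unproc s'.unproc) (D.Hits B a) (fun q => ∃ C ∈ l, q ∈ C) ∧
      (s' = s₁ ∨ s₁.blocks.card < s'.blocks.card)) ?_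
      (post := fun _ s' => AbsInv D s' ∧
        D.Covered (SameBlock s'.blocks) (Unproc s'.unproc) (fun _ => False) (fun _ => False) ∧
        (s' = s₁ ∨ s₁.blocks.card < s'.blocks.card)) ?_ ?_).mono ?_
    · rintro C l s' ⟨hinv', hnd, hl, hcov', hprog⟩
      obtain ⟨hC, hCK⟩ := hl C List.mem_cons_self
      refine (wp_abstractSplit hinv' hK hC hCK).mono ?_
      rintro _ s'' ⟨hinv'', hkeep, hsame, hmono, hsmall, hprog'⟩
      rw [List.nodup_cons] at hnd
      refine ⟨hinv'', hnd.2, ?_, ?_, ?_⟩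
      · intro C' hC'
        obtain ⟨h1, h2⟩ := hl C' (List.mem_cons_of_mem _ hC')
        exact ⟨hkeep C' h1 fun h => hnd.1 (h ▸ hC'), h2⟩
      · refine hcov'.split (fun x y hxy => ((hsame x y).1 hxy).1) ?_ hmono hsmall
        rintro x y hxy ⟨C', hC', hy⟩
        rcases List.mem_cons.1 hC' with rfl | hC'
        · exact .inl (((hsame x y).1 hxy).2 hy)
        · exact .inr ⟨C', hC', hy⟩
      · rcases hprog' with rfl | h'
        · exact hprog
        · rcases hprog with rfl | h
          exacts [.inr h', .inr (h.trans h')]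
    · rintro s' ⟨hinv', -, -, hcov', hprog⟩
      exact ⟨hinv', hcov'.not_unprocessed (by simp), hprog⟩
    · intro l hnd hl
      rw [← hs₁] at hl ⊢
      refine ⟨hinv₁, hnd, fun C hC => Finset.mem_filter.1 ((hl C).1 hC), ?_, .inl rfl⟩
      rw [hb₁]
      refine hcov.remove a (· ∈ B) (fun r r₂ hr hr₂ => ⟨B, hB, hr, hr₂⟩) ?_ (fun _ => Iff.rfl) ?_
      · rintro q b r - ⟨B', hB', hr⟩
        by_cases heq : (B', b) = (B, a)
        · obtain ⟨rfl, rfl⟩ := Prod.mk.inj heq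
          exact .inr ⟨rfl, hr⟩
        · refine .inl ⟨B', ?_, hr⟩
          rw [hu₁, Finset.mem_sdiff, Finset.mem_singleton]
          exact ⟨hB', heq⟩
      · rintro x y ⟨C, hC, hxC, hyC⟩ hor
        refine ⟨C, (hl C).2 (Finset.mem_filter.2 ⟨hb₁ ▸ hC, ?_⟩), hyC⟩
        exact hor.elim (fun h => ⟨x, hxC, h⟩) fun h => ⟨y, hyC, h⟩
    · rintro _ s' ⟨hinv', hcov', hprog⟩
      refine ⟨⟨hinv', hcov'⟩, ?_⟩
      rw [Prod.Lex.toLex_lt_toLex]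
      rcases hprog with rfl | hlt'
      · exact .inr ⟨by rw [hb₁], hlt⟩
      · left
        have := Finset.card_le_univ s'.blocks
        rw [hb₁] at hlt'
        dsimp only
        omega
  · rintro s ⟨hinv, hcov⟩ hemp
    refine hinv.blocks_eq_classes (hcov.iff_indist ?_ hinv.equivalence hinv.final hinv.coarse)
    rintro a r ⟨B, hB, -⟩
    rw [not_ne_iff.1 hemp] at hB
    exact Finset.notMem_empty _ hB

end AbstractCorrectness

/-! ### Operations of the concrete algorithm -/

namespace SimpleSet

open Comp

theorem wp_opAdd {cap i : ℕ} {T : SimpleSet} (hi : 1 ≤ i ∧ i ≤ cap)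
    (hT : Multiset.card T < cap) : Wp (opAdd cap i) T fun _ T' => T' = i ::ₘ T :=
  ⟨⟨hi.1, hi.2, hT⟩, ⟨(), _, ⟨hi.1, hi.2, hT⟩, rfl⟩, fun _ _ h => h.2⟩

theorem wp_opRemove {T : SimpleSet} (hT : T ≠ 0) :
    Wp opRemove T fun i T' => i ∈ T ∧ T' = T.erase i :=
  let ⟨i, hi⟩ := Multiset.exists_mem_of_ne_zero hT
  wp_choose ⟨i, _, hi, rfl⟩ fun _ _ h => h

end SimpleSet

section ConcreteCorrectness

open Comp ConcState

section Zoom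

variable {n m : ℕ} {α : Type} {c : ConcState n m} {post : α → ConcState n m → Prop}

/-- An operation that only reads `TRP`. -/
theorem wp_onTRP_of_eq {op : Comp (RP m) α} {P : α → Prop}
    (h : Wp op c.trp fun a r => P a ∧ r = c.trp) (hp : ∀ a, P a → post a c) :
    Wp (onTRP op) c post :=
  wp_zoom (h.mono (by
    rintro a r ⟨ha, rfl⟩
    exact hp a ha))

/-- An operation that only reads `BRP`. -/
theorem wp_onBRP_of_eq {op : Comp (RP n) α} {P : α → Prop}
    (h : Wp op c.brp fun a r => P a ∧ r = c.brp) (hp : ∀ a, P a → post a c) :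
    Wp (onBRP op) c post :=
  wp_zoom (h.mono (by
    rintro a r ⟨ha, rfl⟩
    exact hp a ha))

end Zoom

namespace Indexing

variable {Q : Type u} {A : Type v} [Fintype Q] {D : PTDFA Q A} (e : Indexing D)

theorem exists_state {x : ℕ} (hx : x ∈ Finset.Icc 1 (Fintype.card Q)) :
    ∃ q, (e.state q : ℕ) = x :=
  ⟨e.state.symm ⟨x, hx⟩, by rw [Equiv.apply_symm_apply]⟩

theorem exists_trans {x : ℕ} (hx : x ∈ Finset.Icc 1 D.δ.card) : ∃ t, (e.trans t : ℕ) = x :=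
  ⟨e.trans.symm ⟨x, hx⟩, by rw [Equiv.apply_symm_apply]⟩

theorem state_inj {q q' : Q} (h : (e.state q : ℕ) = e.state q') : q = q' :=
  e.state.injective (Subtype.ext h)

theorem trans_inj {t t' : {x // x ∈ D.δ}} (h : (e.trans t : ℕ) = e.trans t') : t = t' :=
  e.trans.injective (Subtype.ext h)

theorem mem_states {S : Finset Q} {q : Q} : (e.state q : ℕ) ∈ e.states S ↔ q ∈ S := by
  unfold states
  rw [Finset.mem_image]
  exact ⟨fun ⟨q', hq', h⟩ => e.state_inj h ▸ hq', fun h => ⟨q, h, rfl⟩⟩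

theorem states_subset (S : Finset Q) : e.states S ⊆ Finset.Icc 1 (Fintype.card Q) := by
  intro x hx
  obtain ⟨q, -, rfl⟩ := Finset.mem_image.1 hx
  exact (e.state q).2

theorem inTrs_subset (q : ℕ) : e.inTrs q ⊆ Finset.Icc 1 D.δ.card := by
  intro x hx
  obtain ⟨t, -, rfl⟩ := Finset.mem_image.1 hx
  exact (e.trans t).2

theorem mem_inTrs {t : {x // x ∈ D.δ}} {q : ℕ} :
    (e.trans t : ℕ) ∈ e.inTrs q ↔ (e.state t.1.2.2 : ℕ) = q := by
  unfold inTrs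
  rw [Finset.mem_image]
  constructor
  · rintro ⟨t', ht', h⟩
    obtain rfl := e.trans_inj h
    exact (Finset.mem_filter.1 ht').2
  · exact fun h => ⟨t, Finset.mem_filter.2 ⟨Finset.mem_attach _ _, h⟩, rfl⟩

theorem mem_transitions [DecidableEq Q] [DecidableEq A] {t : {x // x ∈ D.δ}} {S : Finset (Q × A × Q)} :
    (e.trans t : ℕ) ∈ e.transitions S ↔ t.1 ∈ S := by
  unfold transitions
  rw [Finset.mem_image]
  constructor
  · rintro ⟨t', ht', h⟩
    obtain rfl := e.trans_inj h
    exact (Finset.mem_filter.1 ht').2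
  · exact fun h => ⟨t, Finset.mem_filter.2 ⟨Finset.mem_attach _ _, h⟩, rfl⟩

end Indexing

/-- The effect of marking the elements satisfying `S` in the refinable partition `r` while
maintaining the simple set of the sets that contain marks. -/
structure Marking {max : ℕ} (r : RP max) (S : ℕ → Prop) (r' : RP max) (T : SimpleSet) : Prop where
  wf : r'.WellFormed
  sets : r'.sets = r.sets
  sidx : r'.sidx = r.sidx
  marked : ∀ x ∈ Finset.Icc 1 max, r'.Marked x ↔ r.Marked x ∨ S x
  touched : r'.Touched T

theorem Marking.trans {max : ℕ} {r r' r'' : RP max} {S S' S'' : ℕ → Prop} {T T' : SimpleSet}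
    (h : Marking r S r' T) (h' : Marking r' S' r'' T')
    (hS : ∀ x ∈ Finset.Icc 1 max, S'' x ↔ S x ∨ S' x) : Marking r S'' r'' T' where
  wf := h'.wf
  sets := h'.sets.trans h.sets
  sidx := h'.sidx.trans h.sidx
  marked x hx := by rw [h'.marked x hx, h.marked x hx, hS x hx, or_assoc]
  touched := h'.touched

theorem Marking.refl {max : ℕ} {r : RP max} {S : ℕ → Prop} {T : SimpleSet} (hwf : r.WellFormed)
    (hT : r.Touched T) (hS : ∀ x ∈ Finset.Icc 1 max, ¬ S x) : Marking r S r T where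
  wf := hwf
  sets := rfl
  sidx := rfl
  marked x hx := ⟨.inl, fun h => h.resolve_right (hS x hx)⟩
  touched := hT

variable {n m : ℕ}

/-- Marks one transition and records its set as touched if it had no marks before. -/
theorem wp_touchTransition {c : ConcState n m} (hwf : c.trp.WellFormed)
    (hT : c.trp.Touched c.touchedSpls) {t : ℕ} (ht : t ∈ Finset.Icc 1 m)
    {post : Unit → ConcState n m → Prop}
    (hpost : ∀ r T, Marking c.trp (· = t) r T → post () { c with trp := r, touchedSpls := T }) :
    Wp (do
      let p ← onTRP (RP.opSet t)
      if (← onTRP (RP.opNoMarks p)) then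
        onTouchedSpls (SimpleSet.opAdd m p)
      onTRP (RP.opMark t)) c post := by
  have hs := hwf.sidx_mem t ht
  refine wp_bind (wp_onTRP_of_eq (RP.wp_opSet ht) ?_)
  rintro _ rfl
  refine wp_bind (wp_onTRP_of_eq (RP.wp_opNoMarks hwf hs) ?_)
  intro a ha
  rw [← hT.notMem_iff] at ha
  dsimp only
  split_ifs with ha'
  · have hmem := ha.1 ha'
    refine wp_bind (wp_zoom ((SimpleSet.wp_opAdd (hwf.index_bounds hs)
      (hT.card_lt hwf hs hmem)).mono ?_))
    rintro _ _ rfl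
    refine wp_zoom ((RP.wp_opMark hwf ht).mono ?_)
    rintro _ r ⟨h1, h2, h3, h4⟩
    have := hT.mark ht h3 h4
    rw [if_neg hmem] at this
    exact hpost r _ ⟨h1, h2, h3, h4, this⟩
  · have hmem := not_not.1 fun h => ha' (ha.2 h)
    refine wp_zoom ((RP.wp_opMark hwf ht).mono ?_)
    rintro _ r ⟨h1, h2, h3, h4⟩
    have := hT.mark ht h3 h4
    rw [if_pos hmem] at this
    exact hpost r _ ⟨h1, h2, h3, h4, this⟩

theorem wp_touchTransitions {c : ConcState n m} (hwf : c.trp.WellFormed)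
    (hT : c.trp.Touched c.touchedSpls) {S : Finset ℕ} (hS : S ⊆ Finset.Icc 1 m)
    {post : Unit → ConcState n m → Prop}
    (hpost : ∀ r T, Marking c.trp (· ∈ S) r T → post () { c with trp := r, touchedSpls := T }) :
    Wp (forEach (fun _ => S) fun t => do
      let p ← onTRP (RP.opSet t)
      if (← onTRP (RP.opNoMarks p)) then
        onTouchedSpls (SimpleSet.opAdd m p)
      onTRP (RP.opMark t)) c post := by
  refine wp_forEach (fun l c' => (∀ x ∈ l, x ∈ S) ∧ ∃ S' r T, (∀ x, x ∈ S ↔ S' x ∨ x ∈ l) ∧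
    Marking c.trp S' r T ∧ c' = { c with trp := r, touchedSpls := T }) ?_ ?_ ?_
  · rintro t l _ ⟨hl, S', r, T, hS', hm, rfl⟩
    refine wp_touchTransition hm.wf hm.touched (hS (hl t List.mem_cons_self)) ?_
    intro r' T' hm'
    refine ⟨fun x hx => hl x (List.mem_cons_of_mem _ hx), fun x => S' x ∨ x = t, r', T', ?_,
      hm.trans hm' fun _ _ => Iff.rfl, rfl⟩
    intro x
    rw [hS' x, List.mem_cons, or_assoc]
  · rintro _ ⟨-, S', r, T, hS', hm, rfl⟩
    have : S' = (· ∈ S) := by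
      funext x
      rw [hS' x]
      simp
    exact hpost r T (this ▸ hm)
  · intro l _ hl
    exact ⟨fun x => (hl x).1, fun _ => False, c.trp, c.touchedSpls, fun x => by simp [hl x],
      .refl hwf hT fun _ _ => id, rfl⟩

/-- Visits the states of the block `b` and touches the transitions into them. -/
theorem wp_touchBlock {Q : Type u} {A : Type v} [Fintype Q] {D : PTDFA Q A}
    (e : Indexing D) {c : ConcState (Fintype.card Q) D.δ.card} (hbrp : c.brp.WellFormed)
    (htrp : c.trp.WellFormed) (hT : c.trp.Touched c.touchedSpls) {b : ℕ}
    (hb : b ∈ Finset.Icc 1 c.brp.sets)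
    {post : ℕ → ConcState (Fintype.card Q) D.δ.card → Prop}
    (hpost : ∀ q r T, Marking c.trp (fun x => ∃ q, q ∈ Finset.Icc 1 (Fintype.card Q) ∧
      c.brp.sidx q = b ∧ x ∈ e.inTrs q) r T → post q { c with trp := r, touchedSpls := T }) :
    Wp (loop (c.brp.elems (c.brp.first b)) (fun q _ => q ≠ 0) fun q => do
      forEach (fun _ => e.inTrs q) fun t => do
        let p ← onTRP (RP.opSet t)
        if (← onTRP (RP.opNoMarks p)) then
          onTouchedSpls (SimpleSet.opAdd D.δ.card p)
        onTRP (RP.opMark t)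
      onBRP (RP.opNext q)) c post := by
  refine RP.wp_traverse hbrp hb (fun visited c' => ∃ r T,
    Marking c.trp (fun x => ∃ q ∈ visited, x ∈ e.inTrs q) r T ∧
      c' = { c with trp := r, touchedSpls := T }) ?_ ?_ ?_
  · rintro visited q _ ⟨r, T, hm, rfl⟩ hq - -
    refine wp_bind (wp_touchTransitions hm.wf hm.touched (e.inTrs_subset q) ?_)
    intro r' T' hm'
    refine wp_onBRP_of_eq (RP.wp_opNext hbrp hq) ?_
    rintro _ rfl
    refine ⟨rfl, r', T', hm.trans hm' fun x _ => ?_, rfl⟩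
    rw [Finset.exists_mem_insert, or_comm]
  · rintro q _ ⟨r, T, hm, rfl⟩
    refine hpost q r T ?_
    convert hm using 4
    rw [Finset.mem_filter, and_assoc]
  · exact ⟨_, _, .refl htrp hT (by simp), rfl⟩

/-- The state of the loop that splits the touched sets of `TRP`, compared with the contents `r₀`
of `TRP` and `un₀` of `Unready_Spls` at its beginning. The sets in `T` have not been split yet, the
others have been split according to the marks in `r₀`. -/
structure Refining {max : ℕ} (r₀ : RP max) (un₀ : SimpleSet) (r : RP max) (T un : SimpleSet) :
    Prop where
  wf : r.WellFormed
  touched : r.Touched T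
  marked : ∀ x ∈ Finset.Icc 1 max, r.Marked x ↔ r₀.Marked x ∧ r₀.sidx x ∈ T
  sidx_of_mem : ∀ x ∈ Finset.Icc 1 max, r₀.sidx x ∈ T → r.sidx x = r₀.sidx x
  same_set : ∀ x ∈ Finset.Icc 1 max, ∀ y ∈ Finset.Icc 1 max, r.sidx x = r.sidx y ↔
    r₀.sidx x = r₀.sidx y ∧ (r₀.sidx x ∉ T → (r₀.Marked x ↔ r₀.Marked y))
  nodup : un.Nodup
  mem_sets : ∀ p ∈ un, p ∈ Finset.Icc 1 r.sets
  card : Multiset.card un + r₀.sets = Multiset.card un₀ + r.sets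
  unready : ∀ x ∈ Finset.Icc 1 max, r₀.sidx x ∈ un₀ → r.sidx x ∈ un
  half : ∀ x ∈ Finset.Icc 1 max, ∀ y ∈ Finset.Icc 1 max, r₀.sidx x = r₀.sidx y →
    r₀.sidx x ∉ T → r₀.Marked x → ¬ r₀.Marked y → r.sidx x ∈ un

theorem Refining.split {max : ℕ} {r₀ r r' : RP max} {un₀ T un : SimpleSet}
    (h : Refining r₀ un₀ r T un) {p k : ℕ} (hp : p ∈ T) (hsp : r.IsSplit r' p k) :
    Refining r₀ un₀ r' (T.erase p) (if k = 0 then un else k ::ₘ un) := by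
  have hmemT : ∀ q, q ∈ T.erase p ↔ q ≠ p ∧ q ∈ T := fun q => h.touched.1.mem_erase_iff
  -- The elements of the set `p` are the same as in `r₀`, since `p` has not been split yet.
  have hsidx : ∀ x ∈ Finset.Icc 1 max, r.sidx x = p ↔ r₀.sidx x = p := by
    obtain ⟨z, hz, hzp, hzm⟩ := (h.touched.2 p).1 hp
    have hz₀ := ((h.marked z hz).1 hzm).2
    have hzp₀ : r₀.sidx z = p := by rw [← hzp, h.sidx_of_mem z hz hz₀]
    intro x hx
    have := h.same_set x hx z hz
    rw [hzp, hzp₀] at this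
    rw [this]
    exact ⟨And.left, fun hxp => ⟨hxp, fun hn => absurd (hxp ▸ hp) hn⟩⟩
  have hmk : ∀ x ∈ Finset.Icc 1 max, r.sidx x = p → (r.Marked x ↔ r₀.Marked x) := by
    intro x hx hxp
    rw [h.marked x hx, (hsidx x hx).1 hxp]
    exact and_iff_left hp
  have hmono : ∀ x ∈ Finset.Icc 1 max, r.sidx x ∈ un →
      r'.sidx x ∈ if k = 0 then un else k ::ₘ un := by
    intro x hx hun
    split_ifs with hk
    · rwa [(hsp.of_eq_zero hk).2]
    · rw [Multiset.mem_cons]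
      by_cases hxm : r.sidx x = p ∧ r.Marked x
      · exact .inl ((hsp.of_ne_zero hk).2.2 x hx hxm.1 hxm.2)
      · right
        by_cases hxp : r.sidx x = p
        · rwa [hsp.of_unmarked x hx fun h => hxm ⟨hxp, h⟩]
        · rwa [hsp.of_ne x hx hxp]
  refine ⟨hsp.wf, h.touched.split hsp, ?_, ?_, ?_, ?_, ?_, ?_, ?_, ?_⟩
  · intro x hx
    rw [hsp.marked x hx, h.marked x hx, hmemT, ne_eq, hsidx x hx]
    tauto
  · intro x hx hxT
    rw [hmemT] at hxT
    rw [hsp.of_ne x hx ((hsidx x hx).not.2 hxT.1), h.sidx_of_mem x hx hxT.2]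
  · intro x hx y hy
    rw [hsp.same_set x hx y hy, h.same_set x hx y hy, hmemT]
    have h1 := hsidx x hx
    have h2 := hsidx y hy
    have h3 := hmk x hx
    have h4 := hmk y hy
    grind
  · split_ifs with hk
    · exact h.nodup
    · refine Multiset.nodup_cons.2 ⟨fun hkun => ?_, h.nodup⟩
      have := Finset.mem_Icc.1 (h.mem_sets k hkun)
      have := (hsp.of_ne_zero hk).1
      omega
  · intro q hq
    split_ifs at hq with hk
    · rw [(hsp.of_eq_zero hk).1]
      exact h.mem_sets q hq
    · obtain ⟨hk1, hk2, -⟩ := hsp.of_ne_zero hk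
      rw [hk2, Finset.mem_Icc]
      rcases Multiset.mem_cons.1 hq with rfl | hq
      · omega
      · have := Finset.mem_Icc.1 (h.mem_sets q hq)
        omega
  · have := h.card
    split_ifs with hk
    · rw [(hsp.of_eq_zero hk).1]
      exact this
    · rw [(hsp.of_ne_zero hk).2.1, Multiset.card_cons]
      omega
  · exact fun x hx hun => hmono x hx (h.unready x hx hun)
  · intro x hx y hy hxy hxT hxm hym
    rw [hmemT, not_and_or, not_ne_iff] at hxT
    by_cases hxp : r₀.sidx x = p
    · have hxp' := (hsidx x hx).2 hxp
      have hyp' := (hsidx y hy).2 (hxy ▸ hxp)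
      have hk : k ≠ 0 := by
        intro hk
        have h1 := (hsp.same_set x hx y hy).1 (by rw [(hsp.of_eq_zero hk).2, hxp', hyp'])
        rw [hmk x hx hxp', hmk y hy hyp'] at h1
        exact hym ((h1.2 hxp').1 hxm)
      rw [if_neg hk, Multiset.mem_cons]
      exact .inl ((hsp.of_ne_zero hk).2.2 x hx hxp' ((hmk x hx hxp').2 hxm))
    · exact hmono x hx (h.half x hx y hy hxy (hxT.resolve_left hxp) hxm hym)

/-- Splits every touched set of `TRP` by its marks; the new sets become unprocessed splitters. -/
theorem wp_refine {c : ConcState n m} (hwf : c.trp.WellFormed)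
    (hT : c.trp.Touched c.touchedSpls) (hnd : c.unreadySpls.Nodup)
    (hmem : ∀ p ∈ c.unreadySpls, p ∈ Finset.Icc 1 c.trp.sets)
    {post : Unit → ConcState n m → Prop}
    (hpost : ∀ r un, Refining c.trp c.unreadySpls r 0 un →
      post () { c with trp := r, touchedSpls := 0, unreadySpls := un }) :
    Wp (whileDo (fun s : ConcState n m => s.touchedSpls ≠ 0) do
      let p ← onTouchedSpls SimpleSet.opRemove
      let p' ← onTRP (RP.opSplit p)
      if p' ≠ 0 then
        onUnready (SimpleSet.opAdd m p')) c post := by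
  refine wp_whileDo (γ := ℕ) (fun c' => ∃ r T un, Refining c.trp c.unreadySpls r T un ∧
      c' = { c with trp := r, touchedSpls := T, unreadySpls := un })
    (fun c' => Multiset.card c'.touchedSpls) ?_ ?_ ?_
  · rintro _ ⟨r, T, un, hr, rfl⟩ hne
    refine wp_bind (wp_zoom ((SimpleSet.wp_opRemove hne).mono ?_))
    rintro p _ ⟨hp, rfl⟩
    refine wp_bind (wp_zoom ((RP.wp_opSplit_isSplit hr.wf (hr.touched.mem_sets hr.wf hp)).mono ?_))
    intro k r' hsp
    have hr' := hr.split hp hsp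
    have hlt : Multiset.card (T.erase p) < Multiset.card T := Multiset.card_erase_lt_of_mem hp
    split_ifs with hk
    · rw [if_neg hk] at hr'
      have hn := Multiset.nodup_cons.1 hr'.nodup
      have hk' := hr'.mem_sets k (Multiset.mem_cons_self k un)
      refine wp_zoom ((SimpleSet.wp_opAdd (hr'.wf.index_bounds hk') ?_).mono ?_)
      · exact (RP.card_lt_of_notMem hn.2 (fun q hq => hr'.mem_sets q (Multiset.mem_cons_of_mem hq))
          hk' hn.1).trans_le hr'.wf.sets_le
      · rintro _ _ rfl
        exact ⟨⟨r', _, _, hr', rfl⟩, hlt⟩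
    · rw [if_pos (not_ne_iff.1 hk)] at hr'
      exact wp_pure.2 ⟨⟨r', _, _, hr', rfl⟩, hlt⟩
  · rintro _ ⟨r, T, un, hr, rfl⟩ hne
    obtain rfl : T = 0 := not_ne_iff.1 hne
    exact hpost r un hr
  · refine ⟨c.trp, c.touchedSpls, c.unreadySpls, ⟨hwf, hT, ?_, fun _ _ _ => rfl, ?_, hnd, hmem, rfl,
      fun _ _ => id, ?_⟩, rfl⟩
    · intro x hx
      refine ⟨fun hm => ⟨hm, (hT.2 _).2 ⟨x, hx, rfl, hm⟩⟩, And.left⟩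
    · intro x hx y hy
      refine ⟨fun hxy => ⟨hxy, fun hn => ?_⟩, And.left⟩
      rw [hT.notMem_iff] at hn
      exact iff_of_false (hn x hx rfl) (hn y hy hxy.symm)
    · intro x hx y hy hxy hn hxm
      exact absurd hxm ((hT.notMem_iff _).1 hn x hx rfl)

/-! ### The procedure `Split_block` -/

variable {Q : Type u} {A : Type v} [Fintype Q] {D : PTDFA Q A}

/-- The states `x` and `y` are in the same set of `r`. -/
def SameSet (e : Indexing D) (r : RP (Fintype.card Q)) (x y : Q) : Prop :=
  r.sidx (e.state x) = r.sidx (e.state y)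

/-- Some transition labelled `a` into `r` belongs to an unprocessed splitter. -/
def Unready (e : Indexing D) (c : ConcState (Fintype.card Q) D.δ.card) (a : A) (r : Q) : Prop :=
  ∃ (q : Q) (h : (q, a, r) ∈ D.δ), c.trp.sidx (e.trans ⟨(q, a, r), h⟩) ∈ c.unreadySpls

/-- The data structures are consistent, no transition is marked, and the sets of `TRP` are the
nonempty sets of transitions with a common label into a common block of `BRP`. -/
structure ConcInv (e : Indexing D) (c : ConcState (Fintype.card Q) D.δ.card) : Prop where
  brp : c.brp.WellFormed
  trp : c.trp.WellFormed
  sidx_eq_iff : ∀ t t', c.trp.sidx (e.trans t) = c.trp.sidx (e.trans t') ↔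
    t.1.2.1 = t'.1.2.1 ∧ SameSet e c.brp t.1.2.2 t'.1.2.2
  unmarked : ∀ x ∈ Finset.Icc 1 D.δ.card, ¬ c.trp.Marked x
  nodup : c.unreadySpls.Nodup
  mem_sets : ∀ p ∈ c.unreadySpls, p ∈ Finset.Icc 1 c.trp.sets
  touchedSpls : c.touchedSpls = 0

/-- The changes made by `Split_block(b)`. The last clause says that one half of every split
splitter becomes unprocessed. -/
structure BlockSplit (e : Indexing D) (c : ConcState (Fintype.card Q) D.δ.card) (b : ℕ)
    (c' : ConcState (Fintype.card Q) D.δ.card) : Prop where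
  inv : ConcInv e c'
  touchedBlocks : c'.touchedBlocks = c.touchedBlocks
  isSplit : ∃ k, c.brp.IsSplit c'.brp b k
  card : Multiset.card c'.unreadySpls + c.trp.sets = Multiset.card c.unreadySpls + c'.trp.sets
  unready : ∀ a r, Unready e c a r → Unready e c' a r
  half : ∀ q a r q₂ r₂, (q, a, r) ∈ D.δ → (q₂, a, r₂) ∈ D.δ → SameSet e c.brp r r₂ →
    ¬ SameSet e c'.brp r r₂ → Unready e c' a r ∨ Unready e c' a r₂

theorem wp_splitBlock {e : Indexing D} {c : ConcState (Fintype.card Q) D.δ.card}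
    (h : ConcInv e c) {b : ℕ} (hb : b ∈ Finset.Icc 1 c.brp.sets) :
    Wp (splitBlock e b) c fun _ c' => BlockSplit e c b c' := by
  unfold splitBlock
  refine wp_bind (wp_zoom ((RP.wp_opSplit_isSplit h.brp hb).mono ?_))
  intro k r hsp
  split_ifs with hk
  · obtain ⟨hk1, hsets, hnew⟩ := hsp.of_ne_zero hk
    have hb₁ : b ∈ Finset.Icc 1 r.sets := by
      rw [Finset.mem_Icc] at hb ⊢
      omega
    have hk₁ : k ∈ Finset.Icc 1 r.sets := by
      rw [Finset.mem_Icc]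
      omega
    refine wp_bind (wp_onBRP_of_eq (P := fun _ => True)
      ((RP.wp_opSize hsp.wf hb₁).mono fun _ _ h => ⟨trivial, h⟩) fun k₀ _ => ?_)
    refine wp_bind (wp_onBRP_of_eq (P := fun _ => True)
      ((RP.wp_opSize hsp.wf hk₁).mono fun _ _ h => ⟨trivial, h⟩) fun k₁ _ => ?_)
    -- Which of the two parts is traversed matters only for the running time.
    obtain ⟨b', hb', hor⟩ : ∃ b', b' = (if k₀ < k₁ then b else k) ∧ (b' = b ∨ b' = k) := by
      refine ⟨_, rfl, ?_⟩
      split_ifs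
      exacts [.inl rfl, .inr rfl]
    rw [← hb']
    have hb'₁ : b' ∈ Finset.Icc 1 r.sets := by
      rcases hor with rfl | rfl <;> assumption
    refine wp_bind (wp_onBRP_of_eq (RP.wp_opFirst hsp.wf hb'₁) ?_)
    rintro _ rfl
    have hT : c.trp.Touched c.touchedSpls := by
      rw [h.touchedSpls, RP.touched_zero_iff]
      exact h.unmarked
    refine wp_bind (wp_touchBlock e (c := { c with brp := r }) hsp.wf h.trp hT hb'₁ ?_)
    intro _ r₁ T hm
    refine wp_refine (c := { c with brp := r, trp := r₁, touchedSpls := T }) hm.wf hm.touched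
      h.nodup (by rw [hm.sets]; exact h.mem_sets) ?_
    intro r₂ un hr
    have hmk : ∀ t, r₁.Marked (e.trans t) ↔ r.sidx (e.state t.1.2.2) = b' := by
      intro t
      rw [hm.marked _ (e.trans t).2]
      constructor
      · rintro (h' | ⟨q, -, hqb, hq⟩)
        · exact absurd h' (h.unmarked _ (e.trans t).2)
        · rwa [e.mem_inTrs.1 hq]
      · exact fun hb => .inr ⟨_, (e.state t.1.2.2).2, hb, e.mem_inTrs.2 rfl⟩
    have hbk : b ≠ k := by
      have := Finset.mem_Icc.1 hb
      omega
    -- Two states of one old block are separated iff exactly one of them is in the block `b'`.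
    have hsame : ∀ x y, SameSet e r x y ↔ SameSet e c.brp x y ∧
        (r.sidx (e.state x) = b' ↔ r.sidx (e.state y) = b') := by
      intro x y
      have h1 := hsp.same_set _ (e.state x).2 _ (e.state y).2
      have h2 := hnew _ (e.state x).2
      have h3 := hnew _ (e.state y).2
      have h4 := hsp.of_unmarked _ (e.state x).2
      have h5 := hsp.of_unmarked _ (e.state y).2
      unfold SameSet
      grind
    have hlink : ∀ t t', r₂.sidx (e.trans t) = r₂.sidx (e.trans t') ↔
        t.1.2.1 = t'.1.2.1 ∧ SameSet e r t.1.2.2 t'.1.2.2 := by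
      intro t t'
      rw [hr.same_set _ (e.trans t).2 _ (e.trans t').2, hmk, hmk]
      dsimp only
      rw [hm.sidx, h.sidx_eq_iff, hsame, and_assoc]
      exact and_congr_right fun _ => and_congr_right fun _ =>
        ⟨fun h' => h' (Multiset.notMem_zero _), fun h' _ => h'⟩
    refine ⟨⟨hsp.wf, hr.wf, hlink, RP.touched_zero_iff.1 hr.touched, hr.nodup, hr.mem_sets, rfl⟩,
      rfl, ⟨k, hsp⟩, ?_, ?_, ?_⟩
    · have := hr.card
      dsimp only at this ⊢
      rwa [hm.sets] at this
    · rintro a r' ⟨q, hδ, hq⟩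
      refine ⟨q, hδ, hr.unready _ (e.trans _).2 ?_⟩
      dsimp only
      rwa [hm.sidx]
    · intro q a x q₂ y hδ hδ₂ hxy hxy'
      dsimp only at hxy hxy'
      have heq : r₁.sidx (e.trans ⟨_, hδ⟩) = r₁.sidx (e.trans ⟨_, hδ₂⟩) := by
        rw [hm.sidx]
        exact (h.sidx_eq_iff ⟨_, hδ⟩ ⟨_, hδ₂⟩).2 ⟨rfl, hxy⟩
      rw [hsame] at hxy'
      by_cases hx : r.sidx (e.state x) = b'
      · have hy : r.sidx (e.state y) ≠ b' := fun hy => hxy' ⟨hxy, iff_of_true hx hy⟩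
        exact .inl ⟨q, hδ, hr.half _ (e.trans _).2 _ (e.trans _).2 heq (Multiset.notMem_zero _)
          ((hmk ⟨_, hδ⟩).2 hx) ((hmk ⟨_, hδ₂⟩).not.2 hy)⟩
      · have hy : r.sidx (e.state y) = b' := by
          by_contra hy
          exact hxy' ⟨hxy, iff_of_false hx hy⟩
        exact .inr ⟨q₂, hδ₂, hr.half _ (e.trans _).2 _ (e.trans _).2 heq.symm
          (Multiset.notMem_zero _) ((hmk ⟨_, hδ₂⟩).2 hy) ((hmk ⟨_, hδ⟩).not.2 hx)⟩
  · obtain ⟨-, hsidx⟩ := hsp.of_eq_zero (not_ne_iff.1 hk)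
    have hsame : ∀ x y, SameSet e r x y ↔ SameSet e c.brp x y := by
      intro x y
      unfold SameSet
      rw [hsidx]
    refine wp_pure.2 ⟨⟨hsp.wf, h.trp, ?_, h.unmarked, h.nodup, h.mem_sets, h.touchedSpls⟩,
      rfl, ⟨k, hsp⟩, rfl, fun _ _ => id, ?_⟩
    · intro t t'
      rw [hsame]
      exact h.sidx_eq_iff t t'
    · intro q a x q₂ y _ _ hxy hxy'
      exact absurd ((hsame x y).2 hxy) hxy'

theorem wp_readTail {e : Indexing D} {c : ConcState (Fintype.card Q) D.δ.card}
    (t : {x // x ∈ D.δ}) {post : ℕ → ConcState (Fintype.card Q) D.δ.card → Prop}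
    (hpost : post (e.state t.1.1) c) : Wp (readTail e (e.trans t)) c post := by
  refine wp_choose ⟨e.state t.1.1, c, ⟨(e.trans t).2, ?_⟩, rfl⟩ ?_
  · rw [Subtype.coe_eta, Equiv.symm_apply_apply]
  · rintro _ _ ⟨⟨ht, rfl⟩, rfl⟩
    rwa [Subtype.coe_eta, Equiv.symm_apply_apply]

/-- Marks one state and records its block as touched if it had no marks before. -/
theorem wp_touchState {n m : ℕ} {α : Type} {c : ConcState n m} (hwf : c.brp.WellFormed)
    (hT : c.brp.Touched c.touchedBlocks) {q : ℕ} (hq : q ∈ Finset.Icc 1 n)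
    {next : Comp (ConcState n m) α} {post : α → ConcState n m → Prop}
    (hpost : ∀ r T, Marking c.brp (· = q) r T →
      Wp next { c with brp := r, touchedBlocks := T } post) :
    Wp (do
      let b' ← onBRP (RP.opSet q)
      if (← onBRP (RP.opNoMarks b')) then
        onTouchedBlocks (SimpleSet.opAdd n b')
      onBRP (RP.opMark q)
      next) c post := by
  have hs := hwf.sidx_mem q hq
  refine wp_bind (wp_onBRP_of_eq (RP.wp_opSet hq) ?_)
  rintro _ rfl
  refine wp_bind (wp_onBRP_of_eq (RP.wp_opNoMarks hwf hs) ?_)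
  intro a ha
  rw [← hT.notMem_iff] at ha
  dsimp only
  split_ifs with ha'
  · have hmem := ha.1 ha'
    refine wp_bind (wp_zoom ((SimpleSet.wp_opAdd (hwf.index_bounds hs)
      (hT.card_lt hwf hs hmem)).mono ?_))
    rintro _ _ rfl
    refine wp_bind (wp_zoom ((RP.wp_opMark hwf hq).mono ?_))
    rintro _ r ⟨h1, h2, h3, h4⟩
    have := hT.mark hq h3 h4
    rw [if_neg hmem] at this
    exact hpost r _ ⟨h1, h2, h3, h4, this⟩
  · have hmem := not_not.1 fun h => ha' (ha.2 h)
    refine wp_bind (wp_zoom ((RP.wp_opMark hwf hq).mono ?_))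
    rintro _ r ⟨h1, h2, h3, h4⟩
    have := hT.mark hq h3 h4
    rw [if_pos hmem] at this
    exact hpost r _ ⟨h1, h2, h3, h4, this⟩

/-- Visits the transitions of the splitter `p` and touches the states in which they start. -/
theorem wp_touchSplitter (e : Indexing D) {c : ConcState (Fintype.card Q) D.δ.card}
    (hbrp : c.brp.WellFormed) (htrp : c.trp.WellFormed) (hT : c.brp.Touched c.touchedBlocks)
    {p : ℕ} (hp : p ∈ Finset.Icc 1 c.trp.sets)
    {post : ℕ → ConcState (Fintype.card Q) D.δ.card → Prop}
    (hpost : ∀ t r T, Marking c.brp (fun x => ∃ t, c.trp.sidx (e.trans t) = p ∧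
      x = e.state t.1.1) r T → post t { c with brp := r, touchedBlocks := T }) :
    Wp (loop (c.trp.elems (c.trp.first p)) (fun t _ => t ≠ 0) fun t => do
      let q ← readTail e t
      let b' ← onBRP (RP.opSet q)
      if (← onBRP (RP.opNoMarks b')) then
        onTouchedBlocks (SimpleSet.opAdd (Fintype.card Q) b')
      onBRP (RP.opMark q)
      onTRP (RP.opNext t)) c post := by
  refine RP.wp_traverse htrp hp (fun visited c' => ∃ r T,
    Marking c.brp (fun x => ∃ t, (e.trans t : ℕ) ∈ visited ∧ x = e.state t.1.1) r T ∧
      c' = { c with brp := r, touchedBlocks := T }) ?_ ?_ ?_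
  · rintro visited t _ ⟨r, T, hm, rfl⟩ ht - -
    obtain ⟨t, rfl⟩ := e.exists_trans ht
    refine wp_bind (wp_readTail t ?_)
    refine wp_touchState hm.wf hm.touched (e.state t.1.1).2 ?_
    intro r' T' hm'
    refine wp_onTRP_of_eq (RP.wp_opNext htrp (e.trans t).2) ?_
    rintro _ rfl
    refine ⟨rfl, r', T', hm.trans hm' fun x _ => ?_, rfl⟩
    constructor
    · rintro ⟨t', ht', rfl⟩
      rcases Finset.mem_insert.1 ht' with ht' | ht'
      · right
        rw [e.trans_inj ht']
      · exact .inl ⟨t', ht', rfl⟩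
    · rintro (⟨t', ht', rfl⟩ | rfl)
      · exact ⟨t', Finset.mem_insert_of_mem ht', rfl⟩
      · exact ⟨t, Finset.mem_insert_self _ _, rfl⟩
  · rintro t _ ⟨r, T, hm, rfl⟩
    refine hpost t r T ?_
    convert hm using 5 with x t
    rw [Finset.mem_filter]
    exact (and_iff_right (e.trans t).2).symm
  · exact ⟨_, _, .refl hbrp hT (by simp), rfl⟩

/-! ### The main loop -/

/-- The invariant of the main loop. -/
structure MainInv (e : Indexing D) (c : ConcState (Fintype.card Q) D.δ.card) : Prop where
  inv : ConcInv e c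
  touchedBlocks : c.touchedBlocks = 0
  brp_unmarked : ∀ x ∈ Finset.Icc 1 (Fintype.card Q), ¬ c.brp.Marked x
  coarse : ∀ x y, D.Indist x y → SameSet e c.brp x y
  final : ∀ x y, SameSet e c.brp x y → (x ∈ D.final ↔ y ∈ D.final)
  covered : D.Covered (SameSet e c.brp) (Unready e c) (fun _ => False) fun _ => False

/-- The invariant of the loop over the touched blocks, which the splitter described by `K`
is to split; `N` is the number of splitters processed so far. -/
structure TouchedInv (e : Indexing D) (K : Q → Prop) (N : ℕ)
    (c : ConcState (Fintype.card Q) D.δ.card) : Prop where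
  inv : ConcInv e c
  touched : c.brp.Touched c.touchedBlocks
  marked : ∀ q, c.brp.sidx (e.state q) ∈ c.touchedBlocks → (c.brp.Marked (e.state q) ↔ K q)
  coarse : ∀ x y, D.Indist x y → SameSet e c.brp x y
  final : ∀ x y, SameSet e c.brp x y → (x ∈ D.final ↔ y ∈ D.final)
  covered : D.Covered (SameSet e c.brp) (Unready e c) K
    fun q => c.brp.sidx (e.state q) ∈ c.touchedBlocks
  card : Multiset.card c.unreadySpls + N = c.trp.sets

/-- Splitting a touched block preserves the invariant: its marked states are those in `K`, and
the indices of the other touched blocks do not change. -/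
theorem TouchedInv.split {e : Indexing D} {K : Q → Prop} {N : ℕ}
    {c c₁ c' : ConcState (Fintype.card Q) D.δ.card} (h : TouchedInv e K N c)
    (hK : ∀ x y, D.Indist x y → (K x ↔ K y)) {b : ℕ} (hb : b ∈ c.touchedBlocks)
    (hc₁ : c₁ = { c with touchedBlocks := c.touchedBlocks.erase b })
    (hs : BlockSplit e c₁ b c') : TouchedInv e K N c' := by
  obtain ⟨hinv, htb, ⟨k, hsp⟩, hcard, hun, hhalf⟩ := hs
  have hbrp : c₁.brp = c.brp := by rw [hc₁]
  have hT' : c'.touchedBlocks = c.touchedBlocks.erase b := by rw [htb, hc₁]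
  rw [hbrp] at hsp hhalf
  have hmemT : ∀ p, p ∈ c.touchedBlocks.erase b ↔ p ≠ b ∧ p ∈ c.touchedBlocks :=
    fun p => h.touched.1.mem_erase_iff
  have hsame : ∀ x y, SameSet e c'.brp x y ↔ SameSet e c.brp x y ∧
      (c.brp.sidx (e.state x) = b → (K x ↔ K y)) := by
    intro x y
    unfold SameSet
    rw [hsp.same_set _ (e.state x).2 _ (e.state y).2]
    refine and_congr_right fun hxy => forall_congr' fun hx => ?_
    rw [h.marked x (hx ▸ hb), h.marked y (by rw [← hxy, hx]; exact hb)]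
  refine ⟨hinv, ?_, ?_, ?_, ?_, ?_, ?_⟩
  · rw [hT']
    exact h.touched.split hsp
  · intro q hq
    have hq' := hq
    rw [hT', (h.touched.split hsp).2] at hq'
    obtain ⟨x, hx, hxq, hxm⟩ := hq'
    obtain ⟨hxm', hxb⟩ := (hsp.marked x hx).1 hxm
    have hqb : c.brp.sidx (e.state q) ≠ b :=
      ((hsp.same_set x hx _ (e.state q).2).1 hxq).1 ▸ hxb
    rw [hT', hmemT, hsp.of_ne _ (e.state q).2 hqb] at hq
    rw [hsp.marked _ (e.state q).2, h.marked q hq.2]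
    exact and_iff_left hqb
  · exact fun x y hxy => (hsame x y).2 ⟨h.coarse x y hxy, fun _ => hK x y hxy⟩
  · exact fun x y hxy => h.final x y ((hsame x y).1 hxy).1
  · refine h.covered.split (fun x y hxy => ((hsame x y).1 hxy).1) ?_ ?_ ?_
    · intro x y hxy hy
      rw [hsame] at hxy
      by_cases hyb : c.brp.sidx (e.state y) = b
      · exact .inl (hxy.2 (hxy.1.trans hyb))
      · right
        rw [hT', hmemT, hsp.of_ne _ (e.state y).2 hyb]
        exact ⟨hyb, hy⟩
    · rintro q a r - hr
      apply hun
      rw [hc₁]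
      exact hr
    · exact hhalf
  · have h1 := h.card
    rw [hc₁] at hcard
    dsimp only at hcard
    omega

theorem wp_splitTouched {e : Indexing D} {K : Q → Prop} {N : ℕ}
    {c : ConcState (Fintype.card Q) D.δ.card} (h : TouchedInv e K N c)
    (hK : ∀ x y, D.Indist x y → (K x ↔ K y)) :
    Wp (whileDo (fun s : ConcState (Fintype.card Q) D.δ.card => s.touchedBlocks ≠ 0) do
      let b ← onTouchedBlocks SimpleSet.opRemove
      splitBlock e b) c fun _ c' => TouchedInv e K N c' ∧ c'.touchedBlocks = 0 := by
  refine wp_whileDo (γ := ℕ) (TouchedInv e K N) (fun c' => Multiset.card c'.touchedBlocks)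
    ?_ ?_ h
  · intro c h hne
    refine wp_bind (wp_zoom ((SimpleSet.wp_opRemove hne).mono ?_))
    rintro b _ ⟨hb, rfl⟩
    obtain ⟨c₁, hc₁⟩ : ∃ c₁ : ConcState (Fintype.card Q) D.δ.card,
      c₁ = { c with touchedBlocks := c.touchedBlocks.erase b } := ⟨_, rfl⟩
    have hinv : ConcInv e c₁ := by
      rw [hc₁]
      exact ⟨h.inv.brp, h.inv.trp, h.inv.sidx_eq_iff, h.inv.unmarked, h.inv.nodup, h.inv.mem_sets,
        h.inv.touchedSpls⟩
    have hb₁ : b ∈ Finset.Icc 1 c₁.brp.sets := by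
      rw [hc₁]
      exact h.touched.mem_sets h.inv.brp hb
    rw [← hc₁]
    refine (wp_splitBlock hinv hb₁).mono fun _ c' hs => ⟨h.split hK hb hc₁ hs, ?_⟩
    rw [hs.touchedBlocks, hc₁]
    exact Multiset.card_erase_lt_of_mem hb
  · exact fun s hs hc => ⟨hs, not_ne_iff.1 hc⟩

/-- The main loop takes a splitter, splits all blocks by it, and ends with the coarsest stable
equivalence. -/
theorem wp_mainLoop {e : Indexing D} {c : ConcState (Fintype.card Q) D.δ.card}
    (h : MainInv e c) :
    Wp (whileDo (fun s : ConcState (Fintype.card Q) D.δ.card => s.unreadySpls ≠ 0) do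
      let p ← onUnready SimpleSet.opRemove
      let t₀ ← onTRP (RP.opFirst p)
      let _ ← Comp.loop t₀ (fun t _ => t ≠ 0) fun t => do
        let q ← readTail e t
        let b' ← onBRP (RP.opSet q)
        if (← onBRP (RP.opNoMarks b')) then
          onTouchedBlocks (SimpleSet.opAdd (Fintype.card Q) b')
        onBRP (RP.opMark q)
        onTRP (RP.opNext t)
      Comp.whileDo (fun s => s.touchedBlocks ≠ 0) do
        let b ← onTouchedBlocks SimpleSet.opRemove
        splitBlock e b) c fun _ c' => MainInv e c' ∧ c'.unreadySpls = 0 := by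
  -- The number of processed splitters, `sets - |Unready_Spls|`, grows in every round.
  refine wp_whileDo (γ := ℕ) (MainInv e)
    (fun c => Multiset.card c.unreadySpls + (D.δ.card - c.trp.sets)) ?_
    (fun s hs hc => ⟨hs, not_ne_iff.1 hc⟩) h
  clear h c
  intro c h hne
  refine wp_bind (wp_zoom ((SimpleSet.wp_opRemove hne).mono ?_))
  rintro p _ ⟨hp, rfl⟩
  have hps := h.inv.mem_sets p hp
  refine wp_bind (wp_onTRP_of_eq (RP.wp_opFirst h.inv.trp hps) ?_)
  rintro _ rfl
  have hT : c.brp.Touched c.touchedBlocks := by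
    rw [h.touchedBlocks, RP.touched_zero_iff]
    exact h.brp_unmarked
  refine wp_bind (wp_touchSplitter e
    (c := { c with unreadySpls := c.unreadySpls.erase p }) h.inv.brp h.inv.trp hT hps ?_)
  intro _ r T hm
  obtain ⟨x₀, hx₀, hx₀p⟩ := h.inv.trp.exists_mem hps
  obtain ⟨t₀, rfl⟩ := e.exists_trans hx₀
  have hp_iff : ∀ t, c.trp.sidx (e.trans t) = p ↔
      t.1.2.1 = t₀.1.2.1 ∧ SameSet e c.brp t.1.2.2 t₀.1.2.2 := by
    intro t
    rw [← hx₀p]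
    exact h.inv.sidx_eq_iff t t₀
  obtain ⟨K, hKdef⟩ : ∃ K : Q → Prop, ∀ q, K q ↔
      ∃ r, SameSet e c.brp r t₀.1.2.2 ∧ (q, t₀.1.2.1, r) ∈ D.δ := ⟨_, fun _ => Iff.rfl⟩
  have hK : ∀ x y, D.Indist x y → (K x ↔ K y) := by
    intro x y hxy
    rw [hKdef, hKdef]
    exact hxy.hits_iff (B := fun r => SameSet e c.brp r t₀.1.2.2)
      (fun r r₂ hrr hr => (h.coarse r r₂ hrr).symm.trans hr) _
  have hmk : ∀ q, r.Marked (e.state q) ↔ K q := by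
    intro q
    rw [hm.marked _ (e.state q).2, hKdef]
    constructor
    · rintro (hq | ⟨t, ht, hq⟩)
      · exact absurd hq (h.brp_unmarked _ (e.state q).2)
      · obtain ⟨ha, hr⟩ := (hp_iff t).1 ht
        refine ⟨t.1.2.2, hr, ?_⟩
        rw [e.state_inj hq, ← ha]
        exact t.2
    · rintro ⟨r', hr', hδ⟩
      exact .inr ⟨⟨_, hδ⟩, (hp_iff _).2 ⟨rfl, hr'⟩, rfl⟩
  have hsame : SameSet e r = SameSet e c.brp := by
    funext x y
    unfold SameSet
    rw [hm.sidx]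
  have hpos : 0 < Multiset.card c.unreadySpls := Multiset.card_pos_iff_exists_mem.2 ⟨p, hp⟩
  have hle : Multiset.card c.unreadySpls ≤ c.trp.sets := by
    have := RP.card_lt_of_notMem (h.inv.nodup.erase p)
      (fun q hq => h.inv.mem_sets q (Multiset.mem_of_mem_erase hq)) hps
      h.inv.nodup.notMem_erase
    rw [Multiset.card_erase_of_mem hp] at this
    exact Nat.le_of_pred_lt this
  obtain ⟨c₁, hc₁⟩ : ∃ c₁ : ConcState (Fintype.card Q) D.δ.card,
    c₁ = { c with unreadySpls := c.unreadySpls.erase p, brp := r, touchedBlocks := T } := ⟨_, rfl⟩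
  have hstart : TouchedInv e K (c.trp.sets + 1 - Multiset.card c.unreadySpls) c₁ := by
    rw [hc₁]
    refine ⟨⟨hm.wf, h.inv.trp, ?_, h.inv.unmarked, h.inv.nodup.erase p, ?_, h.inv.touchedSpls⟩,
      hm.touched, fun q _ => hmk q, ?_, ?_, ?_, ?_⟩
    · dsimp only
      rw [hsame]
      exact h.inv.sidx_eq_iff
    · exact fun q hq => h.inv.mem_sets q (Multiset.mem_of_mem_erase hq)
    · dsimp only
      rw [hsame]
      exact h.coarse
    · dsimp only
      rw [hsame]
      exact h.final
    · dsimp only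
      rw [hsame]
      refine h.covered.remove t₀.1.2.1 (fun r => SameSet e c.brp r t₀.1.2.2)
        (fun _ _ hr hr₂ => hr.trans hr₂.symm) ?_ hKdef ?_
      · rintro q a r' - ⟨q₁, hδ, hun⟩
        by_cases heq : c.trp.sidx (e.trans ⟨(q₁, a, r'), hδ⟩) = p
        · exact .inr ((hp_iff _).1 heq)
        · exact .inl ⟨q₁, hδ, (Multiset.mem_erase_of_ne heq).2 hun⟩
      · intro x y hxy hor
        rw [hm.touched.2]
        rcases hor with hx | hy
        · exact ⟨_, (e.state x).2, by rw [hm.sidx]; exact hxy, (hmk x).2 hx⟩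
        · exact ⟨_, (e.state y).2, rfl, (hmk y).2 hy⟩
    · dsimp only
      rw [Multiset.card_erase_of_mem hp]
      have : (Multiset.card c.unreadySpls).pred = Multiset.card c.unreadySpls - 1 := rfl
      omega
  rw [← hc₁]
  refine (wp_splitTouched hstart hK).mono ?_
  rintro _ c' ⟨h', hT'⟩
  refine ⟨⟨h'.inv, hT', ?_, h'.coarse, h'.final, ?_⟩, ?_⟩
  · have := h'.touched
    rw [hT', RP.touched_zero_iff] at this
    exact this
  · refine h'.covered.not_unprocessed fun q hq => ?_
    rw [hT'] at hq
    exact Multiset.notMem_zero _ hq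
  · have h1 := h'.card
    have h2 := h'.inv.trp.sets_le
    have h3 := h.inv.trp.sets_le
    omega

theorem MainInv.represents [DecidableEq Q] {e : Indexing D}
    {c : ConcState (Fintype.card Q) D.δ.card}
    (h : MainInv e c) (hun : c.unreadySpls = 0) :
    c.brp.Represents (D.classes.image e.states) := by
  classical
  have hiff : ∀ x y, SameSet e c.brp x y ↔ D.Indist x y := by
    refine h.covered.iff_indist ?_ ⟨fun _ => rfl, Eq.symm, Eq.trans⟩ h.final h.coarse
    rintro a r ⟨q, hδ, hq⟩
    rw [hun] at hq
    exact Multiset.notMem_zero _ hq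
  have hclass : ∀ C ∈ D.classes, ∃ x, ∀ y, y ∈ C ↔ SameSet e c.brp x y := by
    intro C hC
    obtain ⟨x, hx⟩ := PTDFA.mem_classes.1 hC
    exact ⟨x, fun y => by rw [hx, hiff]⟩
  refine RP.represents_of_sidx_eq_iff h.inv.brp h.brp_unmarked ?_ ?_ ?_ ?_
  · intro B hB
    obtain ⟨C, hC, rfl⟩ := Finset.mem_image.1 hB
    obtain ⟨x, hx⟩ := hclass C hC
    exact ⟨_, e.mem_states.2 ((hx x).2 rfl)⟩
  · intro B hB
    obtain ⟨C, -, rfl⟩ := Finset.mem_image.1 hB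
    exact e.states_subset C
  · intro B hB B' hB' z hz hz'
    obtain ⟨C, hC, rfl⟩ := Finset.mem_image.1 hB
    obtain ⟨C', hC', rfl⟩ := Finset.mem_image.1 hB'
    obtain ⟨x, hx⟩ := hclass C hC
    obtain ⟨x', hx'⟩ := hclass C' hC'
    obtain ⟨z, rfl⟩ := e.exists_state (e.states_subset _ hz)
    rw [e.mem_states, hx] at hz
    rw [e.mem_states, hx'] at hz'
    congr 1
    ext y
    rw [hx, hx']
    unfold SameSet at hz hz' ⊢
    rw [hz, hz']
  · intro x hx y hy
    obtain ⟨x, rfl⟩ := e.exists_state hx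
    obtain ⟨y, rfl⟩ := e.exists_state hy
    constructor
    · intro hxy
      have hC : Finset.univ.filter (fun y => D.Indist x y) ∈ D.classes :=
        PTDFA.mem_classes.2 ⟨x, fun y => by simp⟩
      refine ⟨_, Finset.mem_image_of_mem _ hC, e.mem_states.2 ?_, e.mem_states.2 ?_⟩
      · exact Finset.mem_filter.2 ⟨Finset.mem_univ _, (hiff x x).1 rfl⟩
      · exact Finset.mem_filter.2 ⟨Finset.mem_univ _, (hiff x y).1 hxy⟩
    · rintro ⟨B, hB, hxB, hyB⟩
      obtain ⟨C, hC, rfl⟩ := Finset.mem_image.1 hB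
      obtain ⟨z, hz⟩ := hclass C hC
      rw [e.mem_states, hz] at hxB hyB
      exact hxB.symm.trans hyB

variable [DecidableEq Q] [Fintype A] [DecidableEq A]

theorem wp_initTRP (e : Indexing D) (r : RP D.δ.card) :
    Wp (initTRP e) r fun _ r' => r'.WellFormed ∧
      (∀ x ∈ Finset.Icc 1 D.δ.card, ¬ r'.Marked x) ∧
      ∀ t t', r'.sidx (e.trans t) = r'.sidx (e.trans t') ↔ t.1.2.1 = t'.1.2.1 := by
  have hinto : ∀ (t : {x // x ∈ D.δ}) a,
      (e.trans t : ℕ) ∈ e.transitions (D.into Finset.univ a) ↔ t.1.2.1 = a := by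
    intro t a
    rw [e.mem_transitions]
    unfold PTDFA.into
    rw [Finset.mem_filter]
    exact ⟨fun h => h.2.2, fun h => ⟨t.2, Finset.mem_univ _, h⟩⟩
  have hsub : ∀ S, e.transitions S ⊆ Finset.Icc 1 D.δ.card := by
    intro S x hx
    obtain ⟨t, -, rfl⟩ := Finset.mem_image.1 hx
    exact (e.trans t).2
  unfold initTRP
  obtain ⟨P, hP⟩ : ∃ P, (Finset.univ.filter fun a => D.into Finset.univ a ≠ ∅).image
    (fun a => e.transitions (D.into Finset.univ a)) = P := ⟨_, rfl⟩
  rw [hP]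
  have hmemP : ∀ B, B ∈ P ↔ ∃ t : {x // x ∈ D.δ},
      B = e.transitions (D.into Finset.univ t.1.2.1) := by
    intro B
    rw [← hP, Finset.mem_image]
    constructor
    · rintro ⟨a, ha, rfl⟩
      obtain ⟨t, ht⟩ := Finset.nonempty_iff_ne_empty.2 (Finset.mem_filter.1 ha).2
      obtain ⟨hδ, -, rfl⟩ := Finset.mem_filter.1 ht
      exact ⟨⟨t, hδ⟩, rfl⟩
    · rintro ⟨t, rfl⟩
      refine ⟨_, Finset.mem_filter.2 ⟨Finset.mem_univ _, ?_⟩, rfl⟩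
      exact into_ne_empty (q := t.1.1) (r := t.1.2.2) t.2 (Finset.mem_univ _)
  have hpair : ∀ t t', (∃ B ∈ P, (e.trans t : ℕ) ∈ B ∧ (e.trans t' : ℕ) ∈ B) ↔
      t.1.2.1 = t'.1.2.1 := by
    intro t t'
    constructor
    · rintro ⟨B, hB, ht, ht'⟩
      obtain ⟨t₀, rfl⟩ := (hmemP B).1 hB
      rw [hinto] at ht ht'
      rw [ht, ht']
    · exact fun h => ⟨_, (hmemP _).2 ⟨t, rfl⟩, (hinto _ _).2 rfl, (hinto _ _).2 h.symm⟩
  refine wp_choose ?_ ?_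
  · obtain ⟨r', hwf, hun, hiff⟩ := RP.exists_sidx_eq_iff (max := D.δ.card)
      fun x => if h : x ∈ Finset.Icc 1 D.δ.card then some (e.trans.symm ⟨x, h⟩).1.2.1 else none
    refine ⟨(), r', RP.represents_of_sidx_eq_iff hwf hun ?_ ?_ ?_ ?_⟩
    · intro B hB
      obtain ⟨t, rfl⟩ := (hmemP B).1 hB
      exact ⟨_, (hinto t _).2 rfl⟩
    · intro B hB
      obtain ⟨t, rfl⟩ := (hmemP B).1 hB
      exact hsub _
    · intro B hB B' hB' x hx hx'
      obtain ⟨t, rfl⟩ := (hmemP B).1 hB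
      obtain ⟨t', rfl⟩ := (hmemP B').1 hB'
      obtain ⟨z, rfl⟩ := e.exists_trans (hsub _ hx)
      rw [hinto] at hx hx'
      rw [← hx, ← hx']
    · intro x hx y hy
      rw [hiff x hx y hy, dif_pos hx, dif_pos hy, Option.some_inj, ← hpair,
        Equiv.apply_symm_apply, Equiv.apply_symm_apply]
  · intro _ r' hr'
    refine ⟨hr'.1, fun x hx => hr'.not_marked hx, fun t t' => ?_⟩
    rw [hr'.sidx_eq_iff (e.trans t).2 (e.trans t').2, hpair]

/-- All splitters are unprocessed at first. -/
theorem wp_addAll {n m : ℕ} {c : ConcState n m} (hwf : c.trp.WellFormed)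
    (hun : c.unreadySpls = 0) {post : Unit → ConcState n m → Prop}
    (hpost : ∀ U : SimpleSet, U.Nodup → (∀ p, p ∈ U ↔ p ∈ Finset.Icc 1 c.trp.sets) →
      post () { c with unreadySpls := U }) :
    Wp (forTo 1 c.trp.sets fun p => onUnready (SimpleSet.opAdd m p)) c post := by
  unfold forTo
  refine wp_forList (fun l c' => ∃ U : SimpleSet, c' = { c with unreadySpls := U } ∧ U.Nodup ∧
    l.Nodup ∧ (∀ p ∈ l, p ∈ Finset.Icc 1 c.trp.sets) ∧
    ∀ p, p ∈ U ↔ p ∈ Finset.Icc 1 c.trp.sets ∧ p ∉ l) ?_ ?_ ?_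
  · rintro p l _ ⟨U, rfl, hnd, hl, hmem, hU⟩
    have hp := hmem p List.mem_cons_self
    have hpU : p ∉ U := fun h => ((hU p).1 h).2 List.mem_cons_self
    have hlt := RP.card_lt_of_notMem hnd (fun q hq => ((hU q).1 hq).1) hp hpU
    refine wp_zoom ((SimpleSet.wp_opAdd (hwf.index_bounds hp) (hlt.trans_le hwf.sets_le)).mono ?_)
    rintro _ _ rfl
    rw [List.nodup_cons] at hl
    refine ⟨_, rfl, Multiset.nodup_cons.2 ⟨hpU, hnd⟩, hl.2,
      fun q hq => hmem q (List.mem_cons_of_mem _ hq), fun q => ?_⟩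
    rw [Multiset.mem_cons, hU, List.mem_cons]
    constructor
    · rintro (rfl | ⟨h1, h2⟩)
      · exact ⟨hp, hl.1⟩
      · exact ⟨h1, fun h => h2 (.inr h)⟩
    · rintro ⟨h1, h2⟩
      by_cases hqp : q = p
      · exact .inl hqp
      · exact .inr ⟨h1, fun h => h.elim hqp h2⟩
  · rintro _ ⟨U, rfl, hnd, -, -, hU⟩
    exact hpost U hnd fun p => by simp [hU p]
  · have hr : ∀ p, p ∈ List.range' 1 (c.trp.sets + 1 - 1) ↔ p ∈ Finset.Icc 1 c.trp.sets := by
      intro p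
      rw [List.mem_range'_1, Finset.mem_Icc]
      omega
    refine ⟨c.unreadySpls, rfl, ?_, List.nodup_range', fun p => (hr p).1, fun p => ?_⟩
    · rw [hun]
      exact Multiset.nodup_zero
    · rw [hun, hr]
      exact ⟨fun h => absurd h (Multiset.notMem_zero _), fun h => absurd h.1 h.2⟩

theorem wp_mainPart (hF : D.final.Nonempty) (e : Indexing D)
    {c : ConcState (Fintype.card Q) D.δ.card} (hc : c.IsInitial) :
    Wp (mainPart e) c fun _ c' => c'.brp.Represents (D.classes.image e.states) := by
  obtain ⟨hbrp, hun, htb, hts⟩ := hc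
  have hcard : 1 ≤ Fintype.card Q := by
    obtain ⟨q, -⟩ := hF
    exact Fintype.card_pos_iff.2 ⟨q⟩
  unfold mainPart
  refine wp_bind (wp_zoom ((wp_initTRP e c.trp).mono ?_))
  rintro _ r ⟨hwf, hnm, hlabel⟩
  rw [wp_query_bind]
  refine wp_bind (wp_addAll (c := { c with trp := r }) hwf hun ?_)
  intro U hU hUmem
  refine wp_bind ((RP.wp_markEach
    (fun b => { c with trp := r, unreadySpls := U, brp := b }) (fun _ _ _ h => by
      unfold onBRP
      exact wp_zoom h)
    (hbrp.wellFormed hcard) (e.states_subset D.final)).mono ?_)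
  rintro _ _ ⟨b, rfl, hbwf, hbsets, hbsidx, hbmk⟩
  have hone : ∀ q, b.sidx (e.state q) = 1 := by
    intro q
    rw [hbsidx]
    exact hbrp.sidx (e.state q).2
  have hmk : ∀ q, b.Marked (e.state q) ↔ q ∈ D.final := by
    intro q
    rw [hbmk _ (e.state q).2, e.mem_states]
    exact ⟨fun h => h.resolve_left (hbrp.not_marked (e.state q).2), .inr⟩
  have hinv : ConcInv e { c with trp := r, unreadySpls := U, brp := b } := by
    refine ⟨hbwf, hwf, fun t t' => ?_, hnm, hU, fun p => (hUmem p).1, hts⟩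
    refine (hlabel t t').trans (and_iff_left ?_).symm
    exact (hone _).trans (hone _).symm
  have h1 : 1 ∈ Finset.Icc 1 b.sets := by
    rw [hbsets, hbrp.1]
    simp
  refine wp_bind ((wp_splitBlock hinv h1).mono ?_)
  rintro _ c' ⟨hinv', htb', ⟨k, hsp⟩, -, hun', -⟩
  have hsame : ∀ x y, SameSet e c'.brp x y ↔ (x ∈ D.final ↔ y ∈ D.final) := by
    intro x y
    unfold SameSet
    rw [hsp.same_set _ (e.state x).2 _ (e.state y).2]
    dsimp only
    rw [hone, hone, hmk, hmk]
    exact ⟨fun h => h.2 rfl, fun h => ⟨rfl, fun _ => h⟩⟩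
  refine (wp_mainLoop ⟨hinv', htb'.trans htb, ?_, ?_, ?_, ?_⟩).mono
    fun _ c'' h => h.1.represents h.2
  · intro x hx hm
    obtain ⟨q, rfl⟩ := e.exists_state hx
    exact ((hsp.marked _ hx).1 hm).2 (hone q)
  · exact fun x y hxy => (hsame x y).2 hxy.final_iff
  · exact fun x y => (hsame x y).1
  · exact .of_all fun q a r' hδ =>
      hun' a r' ⟨q, hδ, (hUmem _).2 (hwf.sidx_mem _ (e.trans ⟨_, hδ⟩).2)⟩

end ConcreteCorrectness

theorem mainTheorem2 {Q : Type u} {A : Type v}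
    [Fintype Q] [DecidableEq Q] [Fintype A] [DecidableEq A] (D : PTDFA Q A)
    (hrel : ∀ q : Q, D.Relevant q) (hF : D.final.Nonempty) :
    ∃ blocks : Finset (Finset Q),
      (∀ s₀ : AbsState Q A,
        (abstractMain D).Guarantees s₀ fun s => s.blocks = blocks) ∧
      ∀ (e : Indexing D) (s₀ : ConcState (Fintype.card Q) D.δ.card), s₀.IsInitial →
        (mainPart e).Guarantees s₀ fun s => s.brp.Represents (blocks.image e.states) :=
  ⟨D.classes, fun s₀ => Comp.guarantees_of_wp (wp_abstractMain D hF s₀),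
    fun e _ hs₀ => Comp.guarantees_of_wp (wp_mainPart hF e hs₀)⟩
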